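/- **Setting.** Let $\Omega\subset\mathbb R^2$ be open with a finite conforming triangulation $\mathcal T$ by curved triangles (diffeomorphic images, smooth up to the boundary, of a closed triangle; $\bigcup_{T\in\mathcal T}T=\overline\Omega$; two distinct elements meet in the empty set, a common vertex or a common edge). $\mathring{\mathcal F}$ is the set of edges not contained in $\partial\Omega$; each has its relative interior in $\Omega$ and is shared by exactly two elements. $\mathring{\mathcal E}$ is the set of vertices not on $\partial\Omega$, and $\mathcal F_E$ is the set of edges with end point $E$. Piecewise smooth fields are smooth up to the boundary on each $T$. $\mathrm{Regge}(\mathcal T)$ is the space of piecewise smooth symmetric covariant 2-tensors $\sigma$ such that $\sigma(X,Y)$ is single-valued on every $F\in\mathring{\mathcal F}$ for $X,Y$ tangent to $F$. Let $g\in\mathrm{Regge}(\mathcal T)$ be positive definite on every $T$. Let $\mathcal U$ be the space of piecewise smooth functions that are continuous on $\Omega$, and $\mathring{\mathcal U}$ the subspace of those vanishing on the edges contained in $\partial\Omega$. On each $T$ let $\nabla$ be the Levi-Civita connection of $g$, $\mathcal R(X,Y,Z,W)=g(\nabla_X\nabla_YZ-\nabla_Y\nabla_XZ-\nabla_{[X,Y]}Z,W)$,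 $K$ the Gauss curvature, $\omega=\sqrt{\det g}\,dx^1\wedge dx^2$, and let $\omega_T$, $\omega_F$ be the area and length elements. $\langle\cdot,\cdot\rangle$ is the tensor inner product induced by $g$, $(\nabla^2\sigma)(X,Y,\cdot,\cdot)=(\nabla(\nabla\sigma))(X,Y,\cdot,\cdot)$, $(SA)(X,Y,Z,W)=A(X,Z,Y,W)$, $g(L_\sigma X,Y)=\sigma(X,Y)$ and $(L^{(1)}_\sigma\mathcal R)(X,Y,Z,W)=\mathcal R(L_\sigma X,Y,Z,W)$. On an edge $F$ of $T$ let $n=n_F^T$ be the $g$-unit normal pointing into $T$, $t$ the tangent for which $(t,n)$ is a right-handed $g$-orthonormal frame, $\mathrm{I\!I}^n(X,Y)=-g(\nabla_Xn,Y)$ and $\kappa^n=g(\nabla_tt,n)$. For an end point $E$ of $F$, $\nu=\nu_E^F$ is the $g$-unit tangent of $F$ at $E$ pointing into $F$. The jump $[\![B]\!]_F$ is the sum of the values $B^{n_F^{T}}$ from the two elements $T$ containing $F$; likewise $[\![\sigma_{n\nu}]\!]_F^E$ is the sum of $\sigma|_T(n_F^T,\nu_E^F)$ over the two elements containing $F$.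 $\Theta_E$ is $2\pi$ minus the sum of the interior angles at $E$, measured by $g|_T$, of the elements containing $E$. For $A$ a covariant 4-tensor, $A_{FnnF}(X,Y)=A(X,n,n,Y)$ for $X,Y$ tangent to $F$. Let $\mathcal A$ be the space of piecewise smooth covariant 4-tensors $A$ with $A(X,Y,Z,W)=-A(Y,X,Z,W)=-A(X,Y,W,Z)=A(Z,W,X,Y)$ for which $A_{FnnF}$ is single-valued on every $F\in\mathring{\mathcal F}$, and $\mathring{\mathcal A}$ the subspace of those with $A_{FnnF}=0$ on the edges in $\partial\Omega$. Set $$\widetilde{\mathcal R\omega}(A)=\sum_T\int_T\langle\mathcal R,A\rangle\,\omega_T+4\sum_{F\in\mathring{\mathcal F}}\int_F\langle[\![\mathrm{I\!I}]\!],A_{FnnF}\rangle\,\omega_F+4\sum_{E\in\mathring{\mathcal E}}\Theta_E\,A_{\nu nn\nu}(E),\qquad A\in\mathring{\mathcal A}.$$ For $u\in\mathcal U$ put $\mathbb A u=-u\,\omega\otimes\omega$ and, writing $A=\mathbb Au$, for $\sigma\in\mathrm{Regge}(\mathcal T)$ and $\varepsilon\in\mathbb R$, $$\begin{aligned}a(g;\sigma,u)={}&\sum_T\int_T\big(\langle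 L^{(1)}_\sigma\mathcal R,A\rangle-\tfrac12\mathrm{tr}(\sigma)\langle\mathcal R,A\rangle\big)\omega_T+2\sum_{F\in\mathring{\mathcal F}}\int_F[\![\mathrm{I\!I}]\!]:\big(\sigma_F-\mathrm{tr}(\sigma_F)g_F\big):A_{FnnF}\,\omega_F\\&-2\sum_{E\in\mathring{\mathcal E}}\mathrm{tr}(\sigma_E)\,\Theta_E\,A_{\nu nn\nu}(E),\\ b_\varepsilon(g;\sigma,u)={}&2\sum_T\int_T\langle\nabla^2\sigma,SA\rangle\,\omega_T+2\sum_{F\in\mathring{\mathcal F}}\int_F\big\langle[\![\sigma_{nn}\mathrm{I\!I}+(\nabla\sigma)_{FnF}+\nabla(n\lrcorner\sigma)-(\nabla\sigma)_{nFF}]\!],A_{FnnF}\big\rangle\,\omega_F\\&+2\varepsilon\sum_{E\in\mathring{\mathcal E}}\sum_{F\in\mathcal F_E}[\![\sigma_{n\nu}]\!]_F^E\,A_{\nu nn\nu}(E).\end{aligned}$$ Here $\tau:\sigma:\eta=\tau_{ij}\sigma^{jk}\eta_k{}^i$, the subscript $F$ denotes restriction to tangent vectors of $F$ (so that $(\nabla\sigma)_{FnF}(X,Y)=(\nabla_X\sigma)(n,Y)$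 and $(\nabla\sigma)_{nFF}(X,Y)=(\nabla_n\sigma)(X,Y)$), and $\sigma_E$ is the restriction of $\sigma$ to the zero-dimensional tangent space of the vertex $E$. With $\hat\varepsilon^{ij}=\varepsilon^{ij}/\sqrt{\det g}$ and Christoffel symbols $\Gamma_{ij}^k$, let $$\mathrm{inc}\,\sigma=\hat\varepsilon^{qi}\hat\varepsilon^{jk}\Big(\partial_q\partial_j\sigma_{ik}-\partial_q(\Gamma_{ji}^m\sigma_{mk})-\Gamma_{lq}^l(\partial_j\sigma_{ik}-\Gamma_{ji}^m\sigma_{mk})\Big),\qquad \mathrm{curl}(\sigma)(X)=(\nabla_t\sigma)(n,X)-(\nabla_n\sigma)(t,X),$$ and let the distributional covariant incompatibility operator be, for $u\in\mathring{\mathcal U}$, $$\widetilde{\mathrm{inc}\,\sigma}(u)=\sum_T\Big(\int_T\mathrm{inc}\,\sigma\;u\,\omega_T-\int_{\partial T}\big(\mathrm{curl}(\sigma)(t)+\nabla_t(\sigma_{nt})\big)u\,\omega_{\partial T}\Big)-\sum_{E\in\mathring{\mathcal E}}\sum_{T\ni E}\Big(\sum_{F\subset\partial T,\,F\ni E}\sigma|_T(n_F^T,\nu_E^F)\Big)u(E).$$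 **Proposition.** 1. $\mathcal A=\{\mathbb Au:u\in\mathcal U\}$ and $\mathring{\mathcal A}=\{\mathbb Au:u\in\mathring{\mathcal U}\}$, and for all $u\in\mathring{\mathcal U}$ $$\tfrac14\widetilde{\mathcal R\omega}(\mathbb Au)=\sum_T\int_TK\,u\,\omega_T+\sum_{F\in\mathring{\mathcal F}}\int_F[\![\kappa]\!]_F\,u\,\omega_F+\sum_{E\in\mathring{\mathcal E}}\Theta_E\,u(E).$$ 2. For all $\sigma\in\mathrm{Regge}(\mathcal T)$ and $u\in\mathcal U$: $a(g;\sigma,u)=0$, and for every $\varepsilon\in\mathbb R$ $$b_\varepsilon(g;\sigma,u)=-2\sum_T\int_T\mathrm{inc}\,\sigma\;u\,\omega_T+2\sum_{F\in\mathring{\mathcal F}}\int_F[\![\mathrm{curl}(\sigma)(t)+\nabla_t(\sigma_{nt})]\!]_F\,u\,\omega_F+2\varepsilon\sum_{E\in\mathring{\mathcal E}}\sum_{F\in\mathcal F_E}[\![\sigma_{n\nu}]\!]^E_F\,u(E).$$ 3. For all $\sigma\in\mathrm{Regge}(\mathcal T)$ and $u\in\mathring{\mathcal U}$: $b_{1}(g;\sigma,u)=-2\,\widetilde{\mathrm{inc}\,\sigma}(u)$.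 -/

import Mathlib

open MeasureTheory Set
open scoped ContDiff

namespace ReggeCurvature

noncomputable section

/-! ## Pointwise tensor algebra in the standard coordinates of the plane -/

/-- Points and tangent vectors of the plane. -/
abbrev Pt := EuclideanSpace ℝ (Fin 2)

/-- Components of covariant tensors of rank 2, 3, 4 with respect to the coordinate frame. -/
abbrev Tens2 := Matrix (Fin 2) (Fin 2) ℝ
abbrev Tens3 := Fin 2 → Fin 2 → Fin 2 → ℝ
abbrev Tens4 := Fin 2 → Fin 2 → Fin 2 → Fin 2 → ℝ

/-- The coordinate vector `∂_i`. -/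
def coordVec (i : Fin 2) : Pt := EuclideanSpace.single i 1

/-- `B(X, Y)`. -/
def ev2 (B : Tens2) (X Y : Pt) : ℝ := ∑ i, ∑ j, B i j * X i * Y j

/-- `B(X, Y, Z)`. -/
def ev3 (B : Tens3) (X Y Z : Pt) : ℝ := ∑ i, ∑ j, ∑ k, B i j k * X i * Y j * Z k

/-- `B(X, Y, Z, W)`. -/
def ev4 (B : Tens4) (X Y Z W : Pt) : ℝ :=
  ∑ i, ∑ j, ∑ k, ∑ l, B i j k l * X i * Y j * Z k * W l

/-- The inner product of 4-tensors induced by the metric `G`. -/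
def inner4 (G : Tens2) (A B : Tens4) : ℝ :=
  ∑ i, ∑ j, ∑ k, ∑ l, ∑ p, ∑ q, ∑ r, ∑ s,
    A i j k l * G⁻¹ i p * G⁻¹ j q * G⁻¹ k r * G⁻¹ l s * B p q r s

/-- The trace of a 2-tensor with respect to the metric `G`. -/
def gtrace (G B : Tens2) : ℝ := ∑ i, ∑ j, G⁻¹ i j * B i j

/-- The endomorphism `L_σ` with `G(L_σ X, Y) = σ(X, Y)`; `Lmap G σ m i` is the `m`-th component
of `L_σ ∂_i`. -/
def Lmap (G σ : Tens2) (m i : Fin 2) : ℝ := ∑ l, G⁻¹ m l * σ i l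

/-- `L_σ` inserted into the first argument of a 4-tensor. -/
def Lfirst (G σ : Tens2) (A : Tens4) : Tens4 := fun i j k l => ∑ m, Lmap G σ m i * A m j k l

/-- The exchange of the second and the third argument. -/
def swap23 (A : Tens4) : Tens4 := fun i j k l => A i k j l

/-- The vector `v` scaled to unit length in the metric `G`. -/
def gunit (G : Tens2) (v : Pt) : Pt := (Real.sqrt (ev2 G v v))⁻¹ • v

/-- The covector `X♭`. -/
def flat (G : Tens2) (X : Pt) : Fin 2 → ℝ := fun i => ∑ j, G i j * X j

/-- The wedge product of two covectors (determinant convention). -/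
def wedge (φ η : Fin 2 → ℝ) : Tens2 := Matrix.of fun i j => φ i * η j - η i * φ j

/-- The Hodge dual, a scalar, of a 2-form `η = η₀₁ dx⁰ ∧ dx¹`; it satisfies
`(⋆ η) ω = η` for the volume form `ω = √(det G) dx⁰ ∧ dx¹`. -/
def star2 (G : Tens2) (η : Tens2) : ℝ := η 0 1 / Real.sqrt G.det

/-- The symmetric product of two 0-forms. -/
def symProd (a b : ℝ) : ℝ := (a * b + b * a) / 2

/-- The permutation symbol, and the permutation symbol divided by `√(det G)`. -/
def permSym (i j : Fin 2) : ℝ := if i = j then 0 else if i < j then 1 else -1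
def epsHat (G : Tens2) (i j : Fin 2) : ℝ := permSym i j / Real.sqrt G.det

/-- The vector `t` for which `(t, n)` is a right-handed `G`-orthonormal frame, where `n` is a
`G`-unit vector: `t^i = ε̂^{ij} (n♭)_j`. -/
def rightTangent (G : Tens2) (n : Pt) : Pt :=
  !₂[∑ j, epsHat G 0 j * flat G n j, ∑ j, epsHat G 1 j * flat G n j]

/-- Operations on 2-tensors restricted to a subspace, written in a `G`-orthonormal frame `e` of
that subspace: trace, inner product, cyclic triple product `τ : σ : η`, and the trace-reversed
part `σ - tr(σ) G`. -/
def frameTrace {m : ℕ} (e : Fin m → Pt) (B : Pt → Pt → ℝ) : ℝ := ∑ i, B (e i) (e i)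
def frameInner {m : ℕ} (e : Fin m → Pt) (B C : Pt → Pt → ℝ) : ℝ :=
  ∑ i, ∑ j, B (e i) (e j) * C (e i) (e j)
def frameTriple {m : ℕ} (e : Fin m → Pt) (B C D : Pt → Pt → ℝ) : ℝ :=
  ∑ i, ∑ j, ∑ k, B (e i) (e j) * C (e j) (e k) * D (e k) (e i)
def traceReversed {m : ℕ} (G σ : Tens2) (e : Fin m → Pt) : Pt → Pt → ℝ :=
  fun X Y => ev2 σ X Y - frameTrace e (ev2 σ) * ev2 G X Y

/-! ## Curved triangulations -/

/-- The vertices of the reference triangle. -/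
def refVert : Fin 3 → Pt := ![!₂[0, 0], !₂[1, 0], !₂[0, 1]]

/-- The closed reference triangle. -/
def refTri : Set Pt := convexHull ℝ (range refVert)

/-- The affine parametrization over `[0, 1]` of the edge opposite to the vertex `k`. -/
def refEdge (k : Fin 3) (s : ℝ) : Pt := (1 - s) • refVert (k + 1) + s • refVert (k + 2)

/-- A finite conforming triangulation of the open set `Ω` by curved triangles.  The element `T` is
the image of the reference triangle under the diffeomorphism `chart T`, the facet `F` is the arc
`curve F '' [0, 1]`, and the vertex `E` is the point `pos E`.  The facet of `T` opposite to its
`k`-th vertex is `edge T k`.  The parametrization of each facet is related to the charts of its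
neighbours by reparametrizations of `[0, 1]`. -/
structure CurvedMesh (Ω : Set Pt) where
  nElem : ℕ
  nFacet : ℕ
  nVert : ℕ
  chart : Fin nElem → Pt → Pt
  vert : Fin nElem → Fin 3 → Fin nVert
  edge : Fin nElem → Fin 3 → Fin nFacet
  pos : Fin nVert → Pt
  curve : Fin nFacet → ℝ → Pt
  reparam : Fin nElem → Fin 3 → ℝ → ℝ
  /-- for every facet, one of its sides: an element together with the number of the facet in it -/
  plus : Fin nFacet → Fin nElem × Fin 3
  /-- for every vertex, one of its corners: an element and the number of the vertex in it -/
  corner : Fin nVert → Fin nElem × Fin 3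
  chart_smooth : ∀ T, ContDiffOn ℝ ∞ (chart T) refTri
  chart_injOn : ∀ T, InjOn (chart T) refTri
  chart_regular : ∀ T, ∀ p ∈ refTri, Function.Bijective (fderivWithin ℝ (chart T) refTri p)
  covers : (⋃ T, chart T '' refTri) = closure Ω
  conforming : ∀ T T', T ≠ T' → ∃ a a' : Finset (Fin 3), a ≠ Finset.univ ∧ a' ≠ Finset.univ ∧
    chart T '' refTri ∩ chart T' '' refTri = chart T '' convexHull ℝ (refVert '' a) ∧
    chart T '' refTri ∩ chart T' '' refTri = chart T' '' convexHull ℝ (refVert '' a')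
  chart_vert : ∀ T i, chart T (refVert i) = pos (vert T i)
  pos_injective : Function.Injective pos
  reparam_smooth : ∀ T k, ContDiffOn ℝ ∞ (reparam T k) (Icc 0 1)
  reparam_bijOn : ∀ T k, BijOn (reparam T k) (Icc 0 1) (Icc 0 1)
  reparam_regular : ∀ T k, ∀ s ∈ Icc (0 : ℝ) 1, derivWithin (reparam T k) (Icc 0 1) s ≠ 0
  chart_edge : ∀ T k, ∀ s ∈ Icc (0 : ℝ) 1,
    chart T (refEdge k (reparam T k s)) = curve (edge T k) s
  facet_injective : ∀ F F', curve F '' Icc 0 1 = curve F' '' Icc 0 1 → F = F'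
  edge_plus : ∀ F, edge (plus F).1 (plus F).2 = F
  vert_corner : ∀ E, vert (corner E).1 (corner E).2 = E
  /-- a facet is contained in the boundary of `Ω`, or it is shared by exactly two elements and
  its relative interior lies in `Ω` -/
  facet_interior : ∀ F, ¬ curve F '' Icc 0 1 ⊆ frontier Ω →
    (∀ s ∈ Ioo (0 : ℝ) 1, curve F s ∈ Ω) ∧
    (Finset.univ.filter fun q : Fin nElem × Fin 3 => edge q.1 q.2 = F).card = 2

namespace CurvedMesh

variable {Ω : Set Pt} (M : CurvedMesh Ω)

/-- The closed element `T`. -/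
def body (T : Fin M.nElem) : Set Pt := M.chart T '' refTri

/-- The facets that are not contained in the boundary of `Ω`. -/
def intFacets : Finset (Fin M.nFacet) := by
  classical exact Finset.univ.filter fun F => ¬ M.curve F '' Icc 0 1 ⊆ frontier Ω

/-- The vertices that do not lie on the boundary of `Ω`. -/
def intVerts : Finset (Fin M.nVert) := by
  classical exact Finset.univ.filter fun E => M.pos E ∉ frontier Ω

/-- The sides of a facet: the pairs `(T, k)` such that `F` is the `k`-th facet of `T`. -/
def sides (F : Fin M.nFacet) : Finset (Fin M.nElem × Fin 3) :=
  Finset.univ.filter fun q => M.edge q.1 q.2 = F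

/-- The facets with end point `E`. -/
def facetsAt (E : Fin M.nVert) : Finset (Fin M.nFacet) := by
  classical exact Finset.univ.filter fun F => M.curve F 0 = M.pos E ∨ M.curve F 1 = M.pos E

/-- The corners at `E`: the pairs `(T, i)` such that `E` is the `i`-th vertex of `T`. -/
def cornersAt (E : Fin M.nVert) : Finset (Fin M.nElem × Fin 3) :=
  Finset.univ.filter fun q => M.vert q.1 q.2 = E

/-- The velocity of the parametrization of a facet. -/
def velocity (F : Fin M.nFacet) (s : ℝ) : Pt := derivWithin (M.curve F) (Icc 0 1) s

/-- The tangent line of a facet. -/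
def tangentLine (F : Fin M.nFacet) (s : ℝ) : Submodule ℝ Pt :=
  Submodule.span ℝ {M.velocity F s}

/-- The parameter in `{0, 1}` of the end point `E` of `F`. -/
def endParam (F : Fin M.nFacet) (E : Fin M.nVert) : ℝ := by
  classical exact if M.curve F 0 = M.pos E then 0 else 1

/-- A tangent vector of `F` at its end point `E`, pointing from `E` into `F`. -/
def endVelocity (F : Fin M.nFacet) (E : Fin M.nVert) : Pt := by
  classical exact if M.curve F 0 = M.pos E then M.velocity F 0 else -M.velocity F 1

/-! ## Piecewise smooth fields: one smooth field, up to the boundary, on every element -/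

abbrev Scal := Fin M.nElem → Pt → ℝ
abbrev Fld2 := Fin M.nElem → Pt → Tens2
abbrev Fld4 := Fin M.nElem → Pt → Tens4

/-- The partial derivative in the direction `∂_i` within the element `T`. -/
def pd (T : Fin M.nElem) (i : Fin 2) (f : Pt → ℝ) (x : Pt) : ℝ :=
  fderivWithin ℝ f (M.body T) x (coordVec i)

/-- The Regge space: piecewise smooth symmetric 2-tensors whose restriction to tangent vectors of
interior facets is single-valued. -/
structure IsRegge (σ : M.Fld2) : Prop where
  smooth : ∀ T i j, ContDiffOn ℝ ∞ (fun x => σ T x i j) (M.body T)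
  symm : ∀ T, ∀ x ∈ M.body T, ∀ i j, σ T x i j = σ T x j i
  tt_continuous : ∀ F ∈ M.intFacets, ∀ q ∈ M.sides F, ∀ q' ∈ M.sides F, ∀ s ∈ Icc (0 : ℝ) 1,
    ∀ X ∈ M.tangentLine F s, ∀ Y ∈ M.tangentLine F s,
      ev2 (σ q.1 (M.curve F s)) X Y = ev2 (σ q'.1 (M.curve F s)) X Y

/-- A Regge metric: a positive definite element of the Regge space. -/
structure IsReggeMetric (g : M.Fld2) : Prop extends M.IsRegge g where
  posDef : ∀ T, ∀ x ∈ M.body T, (g T x).PosDef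

/-- Piecewise smooth functions that are continuous on `Ω`. -/
structure IsTestFun (u : M.Scal) : Prop where
  smooth : ∀ T, ContDiffOn ℝ ∞ (u T) (M.body T)
  continuous : ∀ T T', ∀ x ∈ Ω, x ∈ M.body T → x ∈ M.body T' → u T x = u T' x

/-- Those that vanish on all boundary facets. -/
structure IsTestFun₀ (u : M.Scal) : Prop extends M.IsTestFun u where
  vanishes : ∀ F, F ∉ M.intFacets → ∀ q ∈ M.sides F, ∀ s ∈ Icc (0 : ℝ) 1,
    u q.1 (M.curve F s) = 0

/-- The value of a test function at a vertex, taken from an adjacent element. -/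
def vertVal (u : M.Scal) (E : Fin M.nVert) : ℝ := u (M.corner E).1 (M.pos E)

/-! ## Levi-Civita connection and curvature of a piecewise smooth metric -/

/-- The Christoffel symbol `Γ^k_{ij}`. -/
def Γ (g : M.Fld2) (T : Fin M.nElem) (k i j : Fin 2) (x : Pt) : ℝ :=
  ∑ l, (g T x)⁻¹ k l * (M.pd T i (fun y => g T y j l) x + M.pd T j (fun y => g T y i l) x
    - M.pd T l (fun y => g T y i j) x) / 2

/-- `R_{ijkl} = g(R_{∂_i, ∂_j} ∂_k, ∂_l)` with
`R_{X, Y} Z = ∇_X ∇_Y Z - ∇_Y ∇_X Z - ∇_{[X, Y]} Z`. -/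
def riemann (g : M.Fld2) : M.Fld4 := fun T x i j k l =>
  ∑ m, g T x l m *
    (M.pd T i (M.Γ g T m j k) x - M.pd T j (M.Γ g T m i k) x
      + ∑ p, (M.Γ g T m i p x * M.Γ g T p j k x - M.Γ g T m j p x * M.Γ g T p i k x))

/-- The Gauss curvature. -/
def gauss (g : M.Fld2) (T : Fin M.nElem) (x : Pt) : ℝ :=
  M.riemann g T x 0 1 1 0 / (g T x).det

/-- `(∇σ)(∂_k, ∂_i, ∂_j) = (∇_{∂_k} σ)(∂_i, ∂_j)`. -/
def cov (g σ : M.Fld2) (T : Fin M.nElem) (x : Pt) : Tens3 := fun k i j =>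
  M.pd T k (fun y => σ T y i j) x
    - ∑ m, (M.Γ g T m k i x * σ T x m j + M.Γ g T m k j x * σ T x i m)

/-- `∇²σ = ∇(∇σ)`, the new differentiation direction being the first argument. -/
def cov2 (g σ : M.Fld2) : M.Fld4 := fun T x q k i j =>
  M.pd T q (fun y => M.cov g σ T y k i j) x
    - ∑ m, (M.Γ g T m q k x * M.cov g σ T x m i j + M.Γ g T m q i x * M.cov g σ T x k m j
      + M.Γ g T m q j x * M.cov g σ T x k i m)

/-- The covariant incompatibility operator on an element, in coordinates. -/
def inc (g σ : M.Fld2) (T : Fin M.nElem) (x : Pt) : ℝ :=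
  ∑ q, ∑ i, ∑ j, ∑ k, epsHat (g T x) q i * epsHat (g T x) j k *
    (M.pd T q (M.pd T j fun y => σ T y i k) x
      - M.pd T q (fun y => ∑ m, M.Γ g T m j i y * σ T y m k) x
      - ∑ l, M.Γ g T l l q x *
          (M.pd T j (fun y => σ T y i k) x - ∑ m, M.Γ g T m j i x * σ T x m k))

/-- `curl(σ)(X) = (∇_t σ)(n, X) - (∇_n σ)(t, X)` in the right-handed frame `(t, n)`. -/
def curl (g σ : M.Fld2) (T : Fin M.nElem) (x : Pt) (n X : Pt) : ℝ :=
  ev3 (M.cov g σ T x) (rightTangent (g T x) n) n X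
    - ev3 (M.cov g σ T x) n (rightTangent (g T x) n) X

/-- The integral over the element `T` with respect to the Riemannian area. -/
def integralElem (g : M.Fld2) (T : Fin M.nElem) (f : Pt → ℝ) : ℝ :=
  ∫ x in M.body T, f x * Real.sqrt (g T x).det

/-! ## Geometry of facets, seen from a side `q = (T, k)` -/

/-- The facet of the side `q`, and the metric of the element of `q` along it. -/
def facet (q : Fin M.nElem × Fin 3) : Fin M.nFacet := M.edge q.1 q.2
def metricAt (g : M.Fld2) (q : Fin M.nElem × Fin 3) (s : ℝ) : Tens2 :=
  g q.1 (M.curve (M.facet q) s)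

/-- The unit tangent field in the direction of the parametrization. -/
def unitTangent (g : M.Fld2) (q : Fin M.nElem × Fin 3) (s : ℝ) : Pt :=
  gunit (M.metricAt g q s) (M.velocity (M.facet q) s)

/-- A vector pointing from the facet into the element: the image under the chart of the vector
from the preimage of the point to the opposite vertex of the reference triangle. -/
def inwardVec (q : Fin M.nElem × Fin 3) (s : ℝ) : Pt :=
  fderivWithin ℝ (M.chart q.1) refTri (refEdge q.2 (M.reparam q.1 q.2 s))
    (refVert q.2 - refEdge q.2 (M.reparam q.1 q.2 s))

/-- The inward unit normal of the facet, obtained from `inwardVec` by orthonormalization against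
the tangent. -/
def normal (g : M.Fld2) (q : Fin M.nElem × Fin 3) (s : ℝ) : Pt :=
  gunit (M.metricAt g q s) (M.inwardVec q s
    - ev2 (M.metricAt g q s) (M.inwardVec q s) (M.unitTangent g q s) • M.unitTangent g q s)

/-- The unit tangent that forms a right-handed frame with the inward normal. -/
def rTangent (g : M.Fld2) (q : Fin M.nElem × Fin 3) (s : ℝ) : Pt :=
  rightTangent (M.metricAt g q s) (M.normal g q s)

/-- The factor `c` with `X = c * velocity`, for `X` tangent to the facet. -/
def coef (g : M.Fld2) (q : Fin M.nElem × Fin 3) (s : ℝ) (X : Pt) : ℝ :=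
  ev2 (M.metricAt g q s) X (M.velocity (M.facet q) s) /
    ev2 (M.metricAt g q s) (M.velocity (M.facet q) s) (M.velocity (M.facet q) s)

/-- `∇_X f` for a function `f`, `∇_X V` for a vector field `V`, and `(∇_X α)(Y)` for a covector
field `α`, all given along the facet, with `X` tangent to the facet. -/
def facetDeriv (g : M.Fld2) (q : Fin M.nElem × Fin 3) (f : ℝ → ℝ) (s : ℝ) (X : Pt) : ℝ :=
  M.coef g q s X * derivWithin f (Icc 0 1) s
def facetCovVec (g : M.Fld2) (q : Fin M.nElem × Fin 3) (V : ℝ → Pt) (s : ℝ) (X : Pt) : Pt :=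
  M.coef g q s X • (derivWithin V (Icc 0 1) s + ∑ m, (∑ l, ∑ j,
    M.Γ g q.1 m l j (M.curve (M.facet q) s) * M.velocity (M.facet q) s l * V s j) • coordVec m)
def facetCovForm (g : M.Fld2) (q : Fin M.nElem × Fin 3) (α : ℝ → Fin 2 → ℝ) (s : ℝ)
    (X Y : Pt) : ℝ :=
  M.coef g q s X * ∑ j, (derivWithin (fun r => α r j) (Icc 0 1) s
    - ∑ l, ∑ m, M.Γ g q.1 m l j (M.curve (M.facet q) s) * M.velocity (M.facet q) s l * α s m)
      * Y j

/-- The second fundamental form `II(X, Y) = -g(∇_X n, Y)` for the inward normal `n`. -/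
def sff (g : M.Fld2) (q : Fin M.nElem × Fin 3) (s : ℝ) (X Y : Pt) : ℝ :=
  -ev2 (M.metricAt g q s) (M.facetCovVec g q (M.normal g q) s X) Y

/-- The geodesic curvature `κ = g(∇_t t, n)` for a unit tangent field `t` and the inward
normal `n`. -/
def geodCurv (g : M.Fld2) (q : Fin M.nElem × Fin 3) (s : ℝ) : ℝ :=
  ev2 (M.metricAt g q s)
    (M.facetCovVec g q (M.unitTangent g q) s (M.unitTangent g q s)) (M.normal g q s)

/-- `curl(σ)(t) + ∇_t (σ(n, t))`, with `(t, n)` right-handed and `n` inward. -/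
def curlTerm (g σ : M.Fld2) (q : Fin M.nElem × Fin 3) (s : ℝ) : ℝ :=
  M.curl g σ q.1 (M.curve (M.facet q) s) (M.normal g q s) (M.rTangent g q s)
    + M.facetDeriv g q
        (fun r => ev2 (σ q.1 (M.curve (M.facet q) r)) (M.normal g q r) (M.rTangent g q r))
        s (M.rTangent g q s)

/-- `σ(n, n) II + (∇σ)(·, n, ·) + ∇(n ⌟ σ) - (∇σ)(n, ·, ·)` on tangent vectors of the facet. -/
def bFacetTensor (g σ : M.Fld2) (q : Fin M.nElem × Fin 3) (s : ℝ) (X Y : Pt) : ℝ :=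
  ev2 (σ q.1 (M.curve (M.facet q) s)) (M.normal g q s) (M.normal g q s) * M.sff g q s X Y
    + ev3 (M.cov g σ q.1 (M.curve (M.facet q) s)) X (M.normal g q s) Y
    + M.facetCovForm g q
        (fun r j => ∑ i, σ q.1 (M.curve (M.facet q) r) i j * M.normal g q r i) s X Y
    - ev3 (M.cov g σ q.1 (M.curve (M.facet q) s)) (M.normal g q s) X Y

/-- `A(X, n, n, Y)`. -/
def Atnnt (g : M.Fld2) (A : M.Fld4) (q : Fin M.nElem × Fin 3) (s : ℝ) (X Y : Pt) : ℝ :=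
  ev4 (A q.1 (M.curve (M.facet q) s)) X (M.normal g q s) (M.normal g q s) Y

/-- The integral over a facet with respect to the arc length in the metric of the side `q`. -/
def integralSide (g : M.Fld2) (q : Fin M.nElem × Fin 3) (f : ℝ → ℝ) : ℝ :=
  ∫ s in (0 : ℝ)..1, f s *
    Real.sqrt (ev2 (M.metricAt g q s) (M.velocity (M.facet q) s) (M.velocity (M.facet q) s))

/-- The integral over the facet `F`; the arc length is the same from both sides. -/
def integralFacet (g : M.Fld2) (F : Fin M.nFacet) (f : ℝ → ℝ) : ℝ :=
  M.integralSide g (M.plus F) f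

/-- The orthonormal frame of the tangent line of `F`. -/
def facetFrame (g : M.Fld2) (F : Fin M.nFacet) (s : ℝ) : Fin 1 → Pt :=
  ![M.unitTangent g (M.plus F) s]

/-- The jump across `F`: the sum of the values from both sides, each taken with the normal
pointing into the respective element. -/
def jump (F : Fin M.nFacet) (B : Fin M.nElem × Fin 3 → ℝ) : ℝ := ∑ q ∈ M.sides F, B q

/-! ## Geometry at vertices -/

/-- The unit conormal of the vertex `E` in the facet of the side `q`, pointing into the facet. -/
def conormal (g : M.Fld2) (q : Fin M.nElem × Fin 3) (E : Fin M.nVert) : Pt :=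
  gunit (g q.1 (M.pos E)) (M.endVelocity (M.facet q) E)

/-- The inward unit normal, at the vertex `E`, of the facet of the side `q`. -/
def endNormal (g : M.Fld2) (q : Fin M.nElem × Fin 3) (E : Fin M.nVert) : Pt :=
  M.normal g q (M.endParam (M.facet q) E)

/-- The interior angle of the element `c.1` at its vertex number `c.2`. -/
def angle (g : M.Fld2) (c : Fin M.nElem × Fin 3) : ℝ :=
  Real.arccos (ev2 (g c.1 (M.pos (M.vert c.1 c.2)))
    (M.conormal g (c.1, c.2 + 1) (M.vert c.1 c.2)) (M.conormal g (c.1, c.2 + 2) (M.vert c.1 c.2)))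

/-- The angle deficit. -/
def deficit (g : M.Fld2) (E : Fin M.nVert) : ℝ :=
  2 * Real.pi - ∑ c ∈ M.cornersAt E, M.angle g c

/-- `A(ν, n, n, ν)` at the vertex `E`, for a facet with end point `E` and an element with this
facet; the value does not depend on their choice. -/
def Acnnc (g : M.Fld2) (A : M.Fld4) (E : Fin M.nVert) : ℝ :=
  ev4 (A (M.corner E).1 (M.pos E))
    (M.conormal g ((M.corner E).1, (M.corner E).2 + 1) E)
    (M.endNormal g ((M.corner E).1, (M.corner E).2 + 1) E)
    (M.endNormal g ((M.corner E).1, (M.corner E).2 + 1) E)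
    (M.conormal g ((M.corner E).1, (M.corner E).2 + 1) E)

/-- `σ(n, ν)` at the vertex `E` from the side `q`. -/
def sigmaNC (g σ : M.Fld2) (q : Fin M.nElem × Fin 3) (E : Fin M.nVert) : ℝ :=
  ev2 (σ q.1 (M.pos E)) (M.endNormal g q E) (M.conormal g q E)

/-! ## Test spaces and functionals -/

/-- Piecewise smooth 4-tensors with the (skew) symmetries of the curvature tensor for which
`A(X, n, n, Y)`, `X` and `Y` tangent to the facet, is single-valued on interior facets. -/
structure IsTestTensor (g : M.Fld2) (A : M.Fld4) : Prop where
  smooth : ∀ T i j k l, ContDiffOn ℝ ∞ (fun x => A T x i j k l) (M.body T)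
  skew_left : ∀ T, ∀ x ∈ M.body T, ∀ i j k l, A T x i j k l = -A T x j i k l
  skew_right : ∀ T, ∀ x ∈ M.body T, ∀ i j k l, A T x i j k l = -A T x i j l k
  pair_symm : ∀ T, ∀ x ∈ M.body T, ∀ i j k l, A T x i j k l = A T x k l i j
  single_valued : ∀ F ∈ M.intFacets, ∀ q ∈ M.sides F, ∀ q' ∈ M.sides F, ∀ s ∈ Icc (0 : ℝ) 1,
    ∀ X ∈ M.tangentLine F s, ∀ Y ∈ M.tangentLine F s, M.Atnnt g A q s X Y = M.Atnnt g A q' s X Y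

/-- Those for which `A(X, n, n, Y)` vanishes on boundary facets. -/
structure IsTestTensor₀ (g : M.Fld2) (A : M.Fld4) : Prop extends M.IsTestTensor g A where
  vanishes : ∀ F, F ∉ M.intFacets → ∀ q ∈ M.sides F, ∀ s ∈ Icc (0 : ℝ) 1,
    ∀ X ∈ M.tangentLine F s, ∀ Y ∈ M.tangentLine F s, M.Atnnt g A q s X Y = 0

/-- The map `u ↦ A` given by
`A(X, Y, Z, W) = ⟨u, ⋆(X♭ ∧ Y♭) ⊙ ⋆(W♭ ∧ Z♭)⟩`, that is, `A = -u ω ⊗ ω`. -/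
def toTensor (g : M.Fld2) (u : M.Scal) : M.Fld4 := fun T x i j k l =>
  u T x * symProd
    (star2 (g T x) (wedge (flat (g T x) (coordVec i)) (flat (g T x) (coordVec j))))
    (star2 (g T x) (wedge (flat (g T x) (coordVec l)) (flat (g T x) (coordVec k))))

/-- The generalized densitized Riemann curvature. -/
def riemannFunctional (g : M.Fld2) (A : M.Fld4) : ℝ :=
  ∑ T, M.integralElem g T (fun x => inner4 (g T x) (M.riemann g T x) (A T x))
  + 4 * ∑ F ∈ M.intFacets, M.integralFacet g F (fun s =>
      frameInner (M.facetFrame g F s) (fun X Y => M.jump F fun q => M.sff g q s X Y)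
        (M.Atnnt g A (M.plus F) s))
  + 4 * ∑ E ∈ M.intVerts, M.deficit g E * M.Acnnc g A E

/-- The distributional densitized Gauss curvature. -/
def gaussFunctional (g : M.Fld2) (u : M.Scal) : ℝ :=
  ∑ T, M.integralElem g T (fun x => M.gauss g T x * u T x)
  + ∑ F ∈ M.intFacets, M.integralFacet g F (fun s =>
      (M.jump F fun q => M.geodCurv g q s) * u (M.plus F).1 (M.curve F s))
  + ∑ E ∈ M.intVerts, M.deficit g E * M.vertVal u E

/-- The bilinear form `a(g; σ, u)`.  The tangent space of a vertex has the empty frame. -/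
def aForm (g σ : M.Fld2) (u : M.Scal) : ℝ :=
  ∑ T, M.integralElem g T (fun x =>
      inner4 (g T x) (Lfirst (g T x) (σ T x) (M.riemann g T x)) (M.toTensor g u T x)
      - gtrace (g T x) (σ T x) / 2 * inner4 (g T x) (M.riemann g T x) (M.toTensor g u T x))
  + 2 * ∑ F ∈ M.intFacets, M.integralFacet g F (fun s =>
      frameTriple (M.facetFrame g F s) (fun X Y => M.jump F fun q => M.sff g q s X Y)
        (traceReversed (M.metricAt g (M.plus F) s) (σ (M.plus F).1 (M.curve F s))
          (M.facetFrame g F s))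
        (M.Atnnt g (M.toTensor g u) (M.plus F) s))
  - 2 * ∑ E ∈ M.intVerts,
      frameTrace (Fin.elim0 : Fin 0 → Pt) (ev2 (σ (M.corner E).1 (M.pos E))) * M.deficit g E
        * M.Acnnc g (M.toTensor g u) E

/-- The bilinear form `b(g; σ, u)`, with the factor `ε` in front of its vertex contribution. -/
def bForm (ε : ℝ) (g σ : M.Fld2) (u : M.Scal) : ℝ :=
  2 * ∑ T, M.integralElem g T (fun x =>
      inner4 (g T x) (M.cov2 g σ T x) (swap23 (M.toTensor g u T x)))
  + 2 * ∑ F ∈ M.intFacets, M.integralFacet g F (fun s =>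
      frameInner (M.facetFrame g F s) (fun X Y => M.jump F fun q => M.bFacetTensor g σ q s X Y)
        (M.Atnnt g (M.toTensor g u) (M.plus F) s))
  + ε * (2 * ∑ E ∈ M.intVerts, ∑ F ∈ M.facetsAt E,
      (M.jump F fun q => M.sigmaNC g σ q E) * M.Acnnc g (M.toTensor g u) E)

/-- The distributional covariant incompatibility operator: the elementwise incompatibility, the
integrals over the element boundaries, and, at every interior vertex, the contributions of the
elements around it from their two facets at this vertex. -/
def incFunctional (g σ : M.Fld2) (u : M.Scal) : ℝ :=
  ∑ T, (M.integralElem g T (fun x => M.inc g σ T x * u T x)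
    - ∑ k, M.integralSide g (T, k) (fun s =>
        M.curlTerm g σ (T, k) s * u T (M.curve (M.facet (T, k)) s)))
  - ∑ E ∈ M.intVerts, ∑ c ∈ M.cornersAt E,
      (M.sigmaNC g σ (c.1, c.2 + 1) E + M.sigmaNC g σ (c.1, c.2 + 2) E) * u c.1 (M.pos E)

end CurvedMesh

end

end ReggeCurvature

open ReggeCurvature

/-! In dimension two a 4-tensor with the symmetries of the curvature tensor has one independent
component, so it equals `-u ω ⊗ ω` with `u = A₀₁₁₀ / det g` (`toTensor_eq`, `eq_ofTensor`). The
proof evaluates every contraction with such a tensor. Two pointwise facts suffice: pairing with it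
antisymmetrizes in both index pairs (`inner4_perm`), and `A(X, n, n, Y) = u g(X, Y)` for a unit
vector `n` and `X` orthogonal to `n`, which is a Gram determinant (`orthonormal_tensor`).

Test spaces: the tangential part of `g` is single-valued on interior facets, so single-valuedness of
`A(X, n, n, Y)` there is that of `u`. Elements may also meet in a vertex only; a punctured disc
around a point of `Ω` is connected, which carries the value of `u` from one element to all others at
that point (`eq_of_facets`).

Elements: the skew symmetries of the curvature give `⟨R, A⟩ = 4 K u`; an endomorphism inserted in
one slot of a 2-form acts through half its trace, which cancels the trace term of `a`; and
antisymmetrizing `∇²σ` leaves `-inc σ u` (`inner4_cov2`).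

Facets: the tangent line has a one-element frame, so everything is evaluated on a unit tangent `t`.
Differentiating `g(t, n) = 0` gives `II(t, t) = κ`. The trace-reversed part of `σ` vanishes in
dimension one. Since `∇_t t = κ n`, the Leibniz rule gives `∇(n ⌟ σ)(t, t) = ∇_t(σ(n, t)) - κ σ(n,
n)`, and the last term cancels `σ(n, n) II` (`bFacetTensor_unitTangent`).

Vertices: `A(ν, n, n, ν) = u(E)`, and the trace over the empty frame is zero. The comparison with
the distributional incompatibility is then double counting: element boundaries are regrouped by
facets (`sum_integralSide`) and facet ends by corners (`sum_facetsAt`). -/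

namespace ReggeCurvature

noncomputable section

/-! ## Pointwise algebra -/

/-- The determinant of the components of two vectors. -/
def cross (X Y : Pt) : ℝ := X 0 * Y 1 - X 1 * Y 0

theorem ev2_eq (B : Tens2) (X Y : Pt) :
    ev2 B X Y = B 0 0 * X 0 * Y 0 + B 0 1 * X 0 * Y 1 + (B 1 0 * X 1 * Y 0 + B 1 1 * X 1 * Y 1) := by
  simp [ev2, Fin.sum_univ_two]

theorem ev2_smul_left (B : Tens2) (c : ℝ) (X Y : Pt) : ev2 B (c • X) Y = c * ev2 B X Y := by
  simp [ev2_eq]; ring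

theorem ev2_smul_right (B : Tens2) (c : ℝ) (X Y : Pt) : ev2 B X (c • Y) = c * ev2 B X Y := by
  simp [ev2_eq]; ring

theorem ev2_sub_left (B : Tens2) (X Y Z : Pt) : ev2 B (X - Y) Z = ev2 B X Z - ev2 B Y Z := by
  simp [ev2_eq]; ring

theorem ev2_comm {B : Tens2} (hB : B 0 1 = B 1 0) (X Y : Pt) : ev2 B X Y = ev2 B Y X := by
  simp [ev2_eq, hB]; ring

theorem cross_smul_right (c : ℝ) (X Y : Pt) : cross X (c • Y) = c * cross X Y := by
  simp [cross]; ring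

theorem cross_self (X : Pt) : cross X X = 0 := by
  simp [cross]; ring

theorem permSym_swap (i j : Fin 2) : permSym i j = -permSym j i := by
  fin_cases i <;> fin_cases j <;> simp [permSym]

theorem posDef_symm {G : Tens2} (hG : G.PosDef) : G 0 1 = G 1 0 := by
  simpa using (hG.isHermitian.apply 1 0)

theorem posDef_ev2_pos {G : Tens2} (hG : G.PosDef) {X : Pt} (hX : X ≠ 0) : 0 < ev2 G X X := by
  have h := (Matrix.posDef_iff_dotProduct_mulVec.1 hG).2 (x := fun i => X i) (by
    intro h; apply hX; ext i; simpa using congrFun h i)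
  simp [Matrix.mulVec, dotProduct, Fin.sum_univ_two] at h
  rw [ev2_eq]; linarith

theorem gunit_unit {G : Tens2} (hG : G.PosDef) {X : Pt} (hX : X ≠ 0) :
    ev2 G (gunit G X) (gunit G X) = 1 := by
  have h := posDef_ev2_pos hG hX
  rw [gunit, ev2_smul_left, ev2_smul_right, ← mul_assoc, ← mul_inv, Real.mul_self_sqrt h.le,
    inv_mul_cancel₀ h.ne']

/-- The Gram determinant of two pairs of vectors. -/
theorem gram_identity {G : Tens2} (hG : G 0 1 = G 1 0) (X Y N : Pt) :
    G.det * cross X N * cross Y N = ev2 G X Y * ev2 G N N - ev2 G X N * ev2 G Y N := by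
  simp [Matrix.det_fin_two, cross, ev2_eq, hG]; ring

theorem sqrt_det_mul_self {G : Tens2} (hG : G.PosDef) :
    Real.sqrt G.det * Real.sqrt G.det = G.det := Real.mul_self_sqrt hG.det_pos.le

/-- Lowering both vectors multiplies the coordinate 2-form by `det G`; the Hodge star divides by its
square root. -/
theorem star2_wedge_flat {G : Tens2} (hG : G.PosDef) (i j : Fin 2) :
    star2 G (wedge (flat G (coordVec i)) (flat G (coordVec j)))
      = Real.sqrt G.det * permSym i j := by
  have h := sqrt_det_mul_self hG
  have h0 : Real.sqrt G.det ≠ 0 := (Real.sqrt_pos.2 hG.det_pos).ne'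
  rw [star2, div_eq_iff h0]
  rw [mul_right_comm, h, Matrix.det_fin_two]
  fin_cases i <;> fin_cases j <;>
    simp [wedge, flat, coordVec, permSym]

/-- Contracting the two permutation symbols produces `cross X N * cross Y N`, so `gram_identity`
applies, and its second product vanishes by orthogonality. -/
theorem orthonormal_tensor {G : Tens2} (hG : G.PosDef) {A : Tens4} {c : ℝ}
    (hA : ∀ i j k l, A i j k l = c * G.det * permSym i j * permSym l k) {X Y N : Pt}
    (hN : ev2 G N N = 1) (hX : ev2 G X N = 0) : ev4 A X N N Y = c * ev2 G X Y := by
  have h := gram_identity (posDef_symm hG) X Y N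
  rw [hN, hX, mul_one, zero_mul, sub_zero] at h
  rw [← h]
  simp [ev4, hA, Fin.sum_univ_two, permSym, cross]
  ring

/-- Raising both indices of the permutation symbol multiplies it by `det G⁻¹`. This happens once for
each index pair, against one factor `det G` in `B`. -/
theorem inner4_perm {G : Tens2} (hG : G.PosDef) (A B : Tens4) (c : ℝ)
    (hB : ∀ i j k l, B i j k l = c * G.det * permSym i j * permSym l k) :
    inner4 G A B
      = c / G.det * ∑ i, ∑ j, ∑ k, ∑ l, A i j k l * permSym i j * permSym l k := by
  have hd : G.det ≠ 0 := hG.det_pos.ne'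
  have hp : ∀ i j : Fin 2, ∑ p, ∑ q, G⁻¹ i p * G⁻¹ j q * permSym p q = permSym i j / G.det := by
    intro i j
    have hdi : G⁻¹ 0 0 * G⁻¹ 1 1 - G⁻¹ 0 1 * G⁻¹ 1 0 = 1 / G.det := by
      rw [← Matrix.det_fin_two, Matrix.det_nonsing_inv, Ring.inverse_eq_inv', one_div]
    fin_cases i <;> fin_cases j <;> simp [Fin.sum_univ_two, permSym] <;>
      simp only [one_div, neg_div] at hdi ⊢ <;> linarith
  have key : ∀ i j k l : Fin 2, ∑ p, ∑ q, ∑ r, ∑ s,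
      A i j k l * G⁻¹ i p * G⁻¹ j q * G⁻¹ k r * G⁻¹ l s * B p q r s
      = A i j k l * (c * G.det) * (permSym i j / G.det) * (permSym l k / G.det) := by
    intro i j k l
    rw [← hp i j, ← hp l k]
    simp only [hB, Fin.sum_univ_two]
    ring
  rw [inner4]
  simp only [key, Finset.mul_sum]
  refine Finset.sum_congr rfl fun i _ => Finset.sum_congr rfl fun j _ =>
    Finset.sum_congr rfl fun k _ => Finset.sum_congr rfl fun l _ => ?_
  field_simp

theorem rightTangent_ortho {G : Tens2} (n : Pt) : ev2 G (rightTangent G n) n = 0 := by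
  simp [ev2_eq, rightTangent, epsHat, permSym, flat, Fin.sum_univ_two]
  ring

theorem rightTangent_unit {G : Tens2} (hG : G.PosDef) {n : Pt} (hn : ev2 G n n = 1) :
    ev2 G (rightTangent G n) (rightTangent G n) = 1 := by
  have h := sqrt_det_mul_self hG
  have h0 : Real.sqrt G.det ≠ 0 := (Real.sqrt_pos.2 hG.det_pos).ne'
  have hs := posDef_symm hG
  have e : ev2 G (rightTangent G n) (rightTangent G n)
      = G.det * ev2 G n n / (Real.sqrt G.det * Real.sqrt G.det) := by
    simp only [ev2_eq, rightTangent, epsHat, permSym, flat, Fin.sum_univ_two]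
    generalize Real.sqrt G.det = r at h0
    rw [Matrix.det_fin_two]
    simp [hs]
    field_simp
    ring
  rw [e, h, hn, mul_one, div_self hG.det_pos.ne']

/-- Two vectors orthogonal to the same nonzero vector are proportional. -/
theorem eq_smul_of_ortho {G : Tens2} (hG : G.PosDef) {X Y N : Pt} (hN : ev2 G N N = 1)
    (hX : ev2 G X N = 0) (hY : ev2 G Y N = 0) (hY1 : ev2 G Y Y = 1) :
    X = ev2 G X Y • Y := by
  have hs := posDef_symm hG
  by_contra hne
  have hZ : X - ev2 G X Y • Y ≠ 0 := fun h => hne (sub_eq_zero.1 h)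
  have hp := posDef_ev2_pos hG hZ
  set Z := X - ev2 G X Y • Y
  have hZN : ev2 G Z N = 0 := by simp [Z, ev2_sub_left, ev2_smul_left, hX, hY]
  have hZY : ev2 G Z Y = 0 := by simp [Z, ev2_sub_left, ev2_smul_left, hY1]
  -- With `N` fixed, the Gram expressions factor through `cross · N`. Hence `G(Z, Z) G(Y, Y) = G(Z,
  -- Y)² = 0`, which contradicts positivity at `Z ≠ 0`.
  have h1 := gram_identity hs Z Y N
  have h2 := gram_identity hs Z Z N
  have h3 := gram_identity hs Y Y N
  rw [hN, hZN, hZY] at h1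
  rw [hN, hZN] at h2
  rw [hN, hY, hY1] at h3
  have h4 : (G.det * cross Z N * cross Z N) * (G.det * cross Y N * cross Y N)
      = (G.det * cross Z N * cross Y N) ^ 2 := by ring
  rw [h1, h2, h3] at h4
  norm_num at h4
  linarith

/-! ## The reference triangle -/

theorem mem_refTri_of {p : Pt} (h0 : 0 ≤ p 0) (h1 : 0 ≤ p 1) (h2 : p 0 + p 1 ≤ 1) :
    p ∈ refTri := by
  have e : p = ∑ i, (![1 - p 0 - p 1, p 0, p 1] : Fin 3 → ℝ) i • refVert i := by
    ext i
    fin_cases i <;> simp [Fin.sum_univ_three, refVert]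
  rw [e, refTri]
  refine (convex_convexHull ℝ _).sum_mem (fun i _ => ?_) ?_ fun i _ =>
    subset_convexHull ℝ _ (mem_range_self i)
  · fin_cases i <;> simp <;> linarith
  · simp [Fin.sum_univ_three]; ring

theorem convex_refTri : Convex ℝ refTri := convex_convexHull ℝ _

theorem isCompact_refTri : IsCompact refTri := (finite_range _).isCompact_convexHull ℝ

theorem interior_refTri_nonempty : (interior refTri).Nonempty := by
  refine ⟨!₂[1 / 4, 1 / 4], mem_interior.2 ⟨{p : Pt | 0 < p 0 ∧ 0 < p 1 ∧ p 0 + p 1 < 1},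
    fun p hp => mem_refTri_of hp.1.le hp.2.1.le hp.2.2.le, ?_, by norm_num⟩⟩
  have c0 : Continuous fun p : Pt => p 0 := by fun_prop
  have c1 : Continuous fun p : Pt => p 1 := by fun_prop
  exact (isOpen_lt continuous_const c0).inter ((isOpen_lt continuous_const c1).inter
    (isOpen_lt (c0.add c1) continuous_const))

theorem uniqueDiffOn_refTri : UniqueDiffOn ℝ refTri :=
  uniqueDiffOn_convex convex_refTri interior_refTri_nonempty

theorem refTri_subset_closure_interior : refTri ⊆ closure (interior refTri) := by
  rw [convex_refTri.closure_interior_eq_closure_of_nonempty_interior interior_refTri_nonempty]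
  exact subset_closure

theorem refEdge_mem {k : Fin 3} {s : ℝ} (hs : s ∈ Icc (0 : ℝ) 1) : refEdge k s ∈ refTri :=
  convex_refTri (subset_convexHull ℝ _ (mem_range_self _)) (subset_convexHull ℝ _ (mem_range_self _))
    (by linarith [hs.2]) hs.1 (by ring)

theorem contDiff_refEdge (k : Fin 3) : ContDiff ℝ ∞ (refEdge k) := by
  unfold refEdge; fun_prop

theorem hasDerivAt_refEdge (k : Fin 3) (s : ℝ) :
    HasDerivAt (refEdge k) (refVert (k + 2) - refVert (k + 1)) s := by
  have h1 := ((hasDerivAt_id s).const_sub 1).smul_const (refVert (k + 1))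
  have h2 := (hasDerivAt_id s).smul_const (refVert (k + 2))
  convert! h1.add h2 using 1
  simp; abel

/-- Up to sign this is twice the area of the reference triangle. It makes the tangent and the inward
vector independent, so that the normal is well defined. -/
theorem cross_refEdge (k : Fin 3) (s : ℝ) :
    cross (refVert (k + 2) - refVert (k + 1)) (refVert k - refEdge k s) ≠ 0 := by
  fin_cases k <;> simp [cross, refVert, refEdge]

namespace CurvedMesh

variable {Ω : Set Pt} (M : CurvedMesh Ω)

/-! ## Elements -/

theorem chart_continuousOn (T : Fin M.nElem) : ContinuousOn (M.chart T) refTri :=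
  (M.chart_smooth T).continuousOn

theorem isCompact_body (T : Fin M.nElem) : IsCompact (M.body T) :=
  isCompact_refTri.image_of_continuousOn (M.chart_continuousOn T)

theorem measurableSet_body (T : Fin M.nElem) : MeasurableSet (M.body T) :=
  (M.isCompact_body T).isClosed.measurableSet

theorem chart_hasFDerivWithinAt (T : Fin M.nElem) {p : Pt} (hp : p ∈ refTri) :
    HasFDerivWithinAt (M.chart T) (fderivWithin ℝ (M.chart T) refTri p) refTri p :=
  (((M.chart_smooth T) p hp).differentiableWithinAt (by simp)).hasFDerivWithinAt

/-- Surjective chart differentials transport unique differentiability from the convex reference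
triangle. All rules for derivatives up to the boundary rest on this. -/
theorem uniqueDiffOn_body (T : Fin M.nElem) : UniqueDiffOn ℝ (M.body T) :=
  uniqueDiffOn_refTri.image (fun _ hp => M.chart_hasFDerivWithinAt T hp)
    fun p hp => (M.chart_regular T p hp).surjective.denseRange

/-- Charts are open at interior points because their differentials are onto; continuity then reaches
the boundary. This serves both the symmetry of second derivatives at boundary points and the
connectedness argument at points of `Ω`. -/
theorem body_subset_closure_interior (T : Fin M.nElem) :
    M.body T ⊆ closure (interior (M.body T)) := by
  have h1 : M.chart T '' interior refTri ⊆ interior (M.body T) := by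
    rintro _ ⟨p, hp, rfl⟩
    have hn := mem_interior_iff_mem_nhds.1 hp
    have hpt := interior_subset hp
    have hc : ContDiffAt ℝ ∞ (M.chart T) p := (M.chart_smooth T).contDiffAt hn
    have hs := hc.hasStrictFDerivAt (by simp)
    rw [← fderivWithin_of_mem_nhds hn] at hs
    have hm := hs.map_nhds_eq_of_surj
      (LinearMap.range_eq_top.2 (M.chart_regular T p hpt).surjective)
    rw [mem_interior_iff_mem_nhds, ← hm]
    exact Filter.mem_map.2 (Filter.mem_of_superset hn (subset_preimage_image _ _))
  rintro _ ⟨p, hp, rfl⟩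
  refine closure_mono h1 ?_
  exact ((M.chart_continuousOn T) p hp |>.mono interior_subset).mem_closure_image
    (refTri_subset_closure_interior hp)

/-! ## Facets -/

theorem curve_eq (q : Fin M.nElem × Fin 3) {s : ℝ} (hs : s ∈ Icc (0 : ℝ) 1) :
    M.curve (M.facet q) s = M.chart q.1 (refEdge q.2 (M.reparam q.1 q.2 s)) :=
  (M.chart_edge q.1 q.2 s hs).symm

theorem refEdge_reparam_mem (q : Fin M.nElem × Fin 3) {s : ℝ} (hs : s ∈ Icc (0 : ℝ) 1) :
    refEdge q.2 (M.reparam q.1 q.2 s) ∈ refTri :=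
  refEdge_mem ((M.reparam_bijOn q.1 q.2).mapsTo hs)

theorem curve_mem_body (q : Fin M.nElem × Fin 3) {s : ℝ} (hs : s ∈ Icc (0 : ℝ) 1) :
    M.curve (M.facet q) s ∈ M.body q.1 := by
  rw [M.curve_eq q hs]
  exact mem_image_of_mem _ (M.refEdge_reparam_mem q hs)

theorem mapsTo_curve (q : Fin M.nElem × Fin 3) :
    MapsTo (M.curve (M.facet q)) (Icc 0 1) (M.body q.1) := fun _ => M.curve_mem_body q

theorem contDiffOn_refEdge_reparam (q : Fin M.nElem × Fin 3) :
    ContDiffOn ℝ ∞ (fun s => refEdge q.2 (M.reparam q.1 q.2 s)) (Icc 0 1) :=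
  (contDiff_refEdge q.2).comp_contDiffOn (M.reparam_smooth q.1 q.2)

theorem contDiffOn_curve (q : Fin M.nElem × Fin 3) :
    ContDiffOn ℝ ∞ (M.curve (M.facet q)) (Icc 0 1) :=
  ((M.chart_smooth q.1).comp (M.contDiffOn_refEdge_reparam q)
    fun _ hs => M.refEdge_reparam_mem q hs).congr fun _ hs => M.curve_eq q hs

theorem uniqueDiffOn_unitInterval : UniqueDiffOn ℝ (Icc (0 : ℝ) 1) :=
  uniqueDiffOn_Icc one_pos

theorem contDiffOn_derivWithin {E : Type*} [NormedAddCommGroup E] [NormedSpace ℝ E] {f : ℝ → E}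
    (hf : ContDiffOn ℝ ∞ f (Icc 0 1)) : ContDiffOn ℝ ∞ (derivWithin f (Icc 0 1)) (Icc 0 1) :=
  hf.derivWithin uniqueDiffOn_unitInterval (by simp)

theorem contDiffOn_velocity (q : Fin M.nElem × Fin 3) :
    ContDiffOn ℝ ∞ (M.velocity (M.facet q)) (Icc 0 1) :=
  contDiffOn_derivWithin (M.contDiffOn_curve q)

theorem curve_hasDerivWithinAt (q : Fin M.nElem × Fin 3) {s : ℝ} (hs : s ∈ Icc (0 : ℝ) 1) :
    HasDerivWithinAt (M.curve (M.facet q)) (M.velocity (M.facet q) s) (Icc 0 1) s :=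
  (((M.contDiffOn_curve q) s hs).differentiableWithinAt (by simp)).hasDerivWithinAt

theorem velocity_eq (q : Fin M.nElem × Fin 3) {s : ℝ} (hs : s ∈ Icc (0 : ℝ) 1) :
    M.velocity (M.facet q) s
      = fderivWithin ℝ (M.chart q.1) refTri (refEdge q.2 (M.reparam q.1 q.2 s))
        (derivWithin (M.reparam q.1 q.2) (Icc 0 1) s •
          (refVert (q.2 + 2) - refVert (q.2 + 1))) := by
  have h1 := (((M.reparam_smooth q.1 q.2) s hs).differentiableWithinAt (by simp)).hasDerivWithinAt
  have h2 := (hasDerivAt_refEdge q.2 (M.reparam q.1 q.2 s)).scomp_hasDerivWithinAt s h1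
  have h3 := (M.chart_hasFDerivWithinAt q.1 (M.refEdge_reparam_mem q hs)).comp_hasDerivWithinAt s h2
    fun _ hs => M.refEdge_reparam_mem q hs
  have h4 := h3.congr (fun r hr => M.curve_eq q hr) (M.curve_eq q hs)
  exact h4.derivWithin (uniqueDiffOn_unitInterval s hs)

theorem velocity_ne_zero (q : Fin M.nElem × Fin 3) {s : ℝ} (hs : s ∈ Icc (0 : ℝ) 1) :
    M.velocity (M.facet q) s ≠ 0 := by
  rw [M.velocity_eq q hs]
  intro h
  have h' := (M.chart_regular q.1 _ (M.refEdge_reparam_mem q hs)).injective (h.trans (map_zero _).symm)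
  rcases smul_eq_zero.1 h' with h1 | h1
  · exact M.reparam_regular q.1 q.2 s hs h1
  · have := cross_refEdge q.2 0
    rw [h1] at this
    simp [cross] at this

/-- The chart differential is injective and the two reference vectors are independent by
`cross_refEdge`. Thus orthonormalization against the tangent never divides by zero. -/
theorem inwardVec_sub_ne_zero (q : Fin M.nElem × Fin 3) {s : ℝ} (hs : s ∈ Icc (0 : ℝ) 1) (c : ℝ) :
    M.inwardVec q s - c • M.velocity (M.facet q) s ≠ 0 := by
  rw [M.velocity_eq q hs, inwardVec, ← map_smul, ← map_sub]
  intro h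
  have h' := (M.chart_regular q.1 _ (M.refEdge_reparam_mem q hs)).injective (h.trans (map_zero _).symm)
  have hc := cross_refEdge q.2 (M.reparam q.1 q.2 s)
  rw [sub_eq_zero.1 h', cross_smul_right, cross_smul_right, cross_self] at hc
  simp at hc

theorem contDiffOn_inwardVec (q : Fin M.nElem × Fin 3) :
    ContDiffOn ℝ ∞ (M.inwardVec q) (Icc 0 1) := by
  have h1 : ContDiffOn ℝ ∞ (fderivWithin ℝ (M.chart q.1) refTri) refTri :=
    (M.chart_smooth q.1).fderivWithin uniqueDiffOn_refTri (by simp)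
  exact (h1.comp (M.contDiffOn_refEdge_reparam q) fun _ hs => M.refEdge_reparam_mem q hs).clm_apply
    (contDiffOn_const.sub (M.contDiffOn_refEdge_reparam q))

theorem facet_plus (F : Fin M.nFacet) : M.facet (M.plus F) = F := M.edge_plus F

theorem mem_sides {F : Fin M.nFacet} {q : Fin M.nElem × Fin 3} :
    q ∈ M.sides F ↔ M.facet q = F := by simp [sides, facet]

theorem velocity_mem_tangentLine (F : Fin M.nFacet) (s : ℝ) :
    M.velocity F s ∈ M.tangentLine F s := Submodule.mem_span_singleton_self _

theorem mem_tangentLine {F : Fin M.nFacet} {s : ℝ} {X : Pt} :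
    X ∈ M.tangentLine F s ↔ ∃ c : ℝ, c • M.velocity F s = X := Submodule.mem_span_singleton

theorem mem_intFacets {F : Fin M.nFacet} :
    F ∈ M.intFacets ↔ ¬ M.curve F '' Icc 0 1 ⊆ frontier Ω := by
  simp [intFacets]

end CurvedMesh

/-! ## Smoothness of pointwise operations -/

theorem contDiffOn_ev2 {E : Type*} [NormedAddCommGroup E] [NormedSpace ℝ E] {S : Set E}
    {G : E → Tens2} {X Y : E → Pt} (hG : ∀ i j, ContDiffOn ℝ ∞ (fun s => G s i j) S)
    (hX : ContDiffOn ℝ ∞ X S) (hY : ContDiffOn ℝ ∞ Y S) :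
    ContDiffOn ℝ ∞ (fun s => ev2 (G s) (X s) (Y s)) S := by
  have h1 := contDiffOn_euclidean.1 hX
  have h2 := contDiffOn_euclidean.1 hY
  unfold ev2
  exact ContDiffOn.sum fun i _ => ContDiffOn.sum fun j _ => ((hG i j).mul (h1 i)).mul (h2 j)

theorem contDiffOn_ev3 {E : Type*} [NormedAddCommGroup E] [NormedSpace ℝ E] {S : Set E}
    {B : E → Tens3} {X Y Z : E → Pt} (hB : ∀ i j k, ContDiffOn ℝ ∞ (fun s => B s i j k) S)
    (hX : ContDiffOn ℝ ∞ X S) (hY : ContDiffOn ℝ ∞ Y S) (hZ : ContDiffOn ℝ ∞ Z S) :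
    ContDiffOn ℝ ∞ (fun s => ev3 (B s) (X s) (Y s) (Z s)) S := by
  have h1 := contDiffOn_euclidean.1 hX
  have h2 := contDiffOn_euclidean.1 hY
  have h3 := contDiffOn_euclidean.1 hZ
  unfold ev3
  exact ContDiffOn.sum fun i _ => ContDiffOn.sum fun j _ => ContDiffOn.sum fun k _ =>
    (((hB i j k).mul (h1 i)).mul (h2 j)).mul (h3 k)

theorem contDiffOn_gunit {E : Type*} [NormedAddCommGroup E] [NormedSpace ℝ E] {S : Set E}
    {G : E → Tens2} {X : E → Pt} (hG : ∀ i j, ContDiffOn ℝ ∞ (fun s => G s i j) S)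
    (hpd : ∀ s ∈ S, (G s).PosDef) (hX : ContDiffOn ℝ ∞ X S) (h0 : ∀ s ∈ S, X s ≠ 0) :
    ContDiffOn ℝ ∞ (fun s => gunit (G s) (X s)) S := by
  have hp : ∀ s ∈ S, 0 < ev2 (G s) (X s) (X s) := fun s hs => posDef_ev2_pos (hpd s hs) (h0 s hs)
  exact (((contDiffOn_ev2 hG hX hX).sqrt fun s hs => (hp s hs).ne').inv
    fun s hs => (Real.sqrt_pos.2 (hp s hs)).ne').smul hX

theorem contDiffOn_det {E : Type*} [NormedAddCommGroup E] [NormedSpace ℝ E] {S : Set E}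
    {G : E → Tens2} (hG : ∀ i j, ContDiffOn ℝ ∞ (fun s => G s i j) S) :
    ContDiffOn ℝ ∞ (fun s => (G s).det) S := by
  simp only [Matrix.det_fin_two]
  exact ((hG 0 0).mul (hG 1 1)).sub ((hG 0 1).mul (hG 1 0))

theorem contDiffOn_rightTangent {E : Type*} [NormedAddCommGroup E] [NormedSpace ℝ E] {S : Set E}
    {G : E → Tens2} {X : E → Pt} (hG : ∀ i j, ContDiffOn ℝ ∞ (fun s => G s i j) S)
    (hpd : ∀ s ∈ S, (G s).PosDef) (hX : ContDiffOn ℝ ∞ X S) :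
    ContDiffOn ℝ ∞ (fun s => rightTangent (G s) (X s)) S := by
  have h1 := contDiffOn_euclidean.1 hX
  have hr : ContDiffOn ℝ ∞ (fun s => Real.sqrt (G s).det) S :=
    (contDiffOn_det hG).sqrt fun s hs => (hpd s hs).det_pos.ne'
  have hr0 : ∀ s ∈ S, Real.sqrt (G s).det ≠ 0 :=
    fun s hs => (Real.sqrt_pos.2 (hpd s hs).det_pos).ne'
  have hf : ∀ i, ContDiffOn ℝ ∞ (fun s => ∑ j, epsHat (G s) i j * flat (G s) (X s) j) S :=
    fun i => ContDiffOn.sum fun j _ => (contDiffOn_const.div hr hr0).mul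
      (ContDiffOn.sum fun k _ => (hG j k).mul (h1 k))
  refine contDiffOn_euclidean.2 fun i => ?_
  fin_cases i
  · exact hf 0
  · exact hf 1

theorem contDiffOn_matrix_inv {E : Type*} [NormedAddCommGroup E] [NormedSpace ℝ E] {S : Set E}
    {G : E → Tens2} (hG : ∀ i j, ContDiffOn ℝ ∞ (fun s => G s i j) S)
    (hpd : ∀ s ∈ S, (G s).PosDef) (i j : Fin 2) :
    ContDiffOn ℝ ∞ (fun s => (G s)⁻¹ i j) S := by
  have h : ∀ i j, ContDiffOn ℝ ∞ (fun s => (G s).det⁻¹ * (G s).adjugate i j) S := by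
    intro i j
    refine ((contDiffOn_det hG).inv fun s hs => (hpd s hs).det_pos.ne').mul ?_
    fin_cases i <;> fin_cases j <;> simp [Matrix.adjugate_fin_two]
    · exact hG 1 1
    · exact (hG 0 1).neg
    · exact (hG 1 0).neg
    · exact hG 0 0
  refine (h i j).congr fun s _ => ?_
  simp [Matrix.inv_def]

namespace CurvedMesh

variable {Ω : Set Pt} {M : CurvedMesh Ω} {g : M.Fld2}

/-! ## Frames along facets -/

theorem IsRegge.contDiffOn_curve {σ : M.Fld2} (hσ : M.IsRegge σ) (q : Fin M.nElem × Fin 3)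
    (i j : Fin 2) :
    ContDiffOn ℝ ∞ (fun s => σ q.1 (M.curve (M.facet q) s) i j) (Icc 0 1) :=
  (hσ.smooth q.1 i j).comp (M.contDiffOn_curve q) (M.mapsTo_curve q)

theorem IsReggeMetric.contDiffOn_metricAt (hg : M.IsReggeMetric g) (q : Fin M.nElem × Fin 3)
    (i j : Fin 2) : ContDiffOn ℝ ∞ (fun s => M.metricAt g q s i j) (Icc 0 1) :=
  hg.toIsRegge.contDiffOn_curve q i j

theorem IsReggeMetric.posDef_metricAt (hg : M.IsReggeMetric g) (q : Fin M.nElem × Fin 3) {s : ℝ}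
    (hs : s ∈ Icc (0 : ℝ) 1) : (M.metricAt g q s).PosDef :=
  hg.posDef q.1 _ (M.curve_mem_body q hs)

theorem IsReggeMetric.contDiffOn_unitTangent (hg : M.IsReggeMetric g)
    (q : Fin M.nElem × Fin 3) : ContDiffOn ℝ ∞ (M.unitTangent g q) (Icc 0 1) :=
  contDiffOn_gunit (hg.contDiffOn_metricAt q) (fun _ hs => hg.posDef_metricAt q hs)
    (M.contDiffOn_velocity q) fun _ hs => M.velocity_ne_zero q hs

theorem IsReggeMetric.unitTangent_unit (hg : M.IsReggeMetric g) (q : Fin M.nElem × Fin 3)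
    {s : ℝ} (hs : s ∈ Icc (0 : ℝ) 1) :
    ev2 (M.metricAt g q s) (M.unitTangent g q s) (M.unitTangent g q s) = 1 :=
  gunit_unit (hg.posDef_metricAt q hs) (M.velocity_ne_zero q hs)

theorem IsReggeMetric.normal_arg_ne_zero (q : Fin M.nElem × Fin 3)
    {s : ℝ} (hs : s ∈ Icc (0 : ℝ) 1) :
    M.inwardVec q s - ev2 (M.metricAt g q s) (M.inwardVec q s) (M.unitTangent g q s) •
      M.unitTangent g q s ≠ 0 := by
  rw [unitTangent, gunit, smul_smul]
  exact M.inwardVec_sub_ne_zero q hs _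

theorem IsReggeMetric.contDiffOn_normal (hg : M.IsReggeMetric g) (q : Fin M.nElem × Fin 3) :
    ContDiffOn ℝ ∞ (M.normal g q) (Icc 0 1) :=
  contDiffOn_gunit (hg.contDiffOn_metricAt q) (fun _ hs => hg.posDef_metricAt q hs)
    ((M.contDiffOn_inwardVec q).sub ((contDiffOn_ev2 (hg.contDiffOn_metricAt q)
      (M.contDiffOn_inwardVec q) (hg.contDiffOn_unitTangent q)).smul (hg.contDiffOn_unitTangent q)))
    fun _ hs => IsReggeMetric.normal_arg_ne_zero q hs

theorem IsReggeMetric.normal_unit (hg : M.IsReggeMetric g) (q : Fin M.nElem × Fin 3)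
    {s : ℝ} (hs : s ∈ Icc (0 : ℝ) 1) :
    ev2 (M.metricAt g q s) (M.normal g q s) (M.normal g q s) = 1 :=
  gunit_unit (hg.posDef_metricAt q hs) (IsReggeMetric.normal_arg_ne_zero q hs)

theorem IsReggeMetric.normal_ortho (hg : M.IsReggeMetric g) (q : Fin M.nElem × Fin 3)
    {s : ℝ} (hs : s ∈ Icc (0 : ℝ) 1) :
    ev2 (M.metricAt g q s) (M.unitTangent g q s) (M.normal g q s) = 0 := by
  rw [ev2_comm (posDef_symm (hg.posDef_metricAt q hs)), normal, gunit, ev2_smul_left]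
  refine mul_eq_zero_of_right _ ?_
  rw [ev2_sub_left, ev2_smul_left, hg.unitTangent_unit q hs, mul_one, sub_self]

theorem IsReggeMetric.sqrt_pos (hg : M.IsReggeMetric g) (q : Fin M.nElem × Fin 3)
    {s : ℝ} (hs : s ∈ Icc (0 : ℝ) 1) :
    0 < Real.sqrt (ev2 (M.metricAt g q s) (M.velocity (M.facet q) s) (M.velocity (M.facet q) s)) :=
  Real.sqrt_pos.2 (posDef_ev2_pos (hg.posDef_metricAt q hs) (M.velocity_ne_zero q hs))

theorem IsReggeMetric.velocity_eq_smul (hg : M.IsReggeMetric g) (q : Fin M.nElem × Fin 3)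
    {s : ℝ} (hs : s ∈ Icc (0 : ℝ) 1) :
    M.velocity (M.facet q) s = Real.sqrt (ev2 (M.metricAt g q s) (M.velocity (M.facet q) s)
      (M.velocity (M.facet q) s)) • M.unitTangent g q s := by
  rw [unitTangent, gunit, smul_smul, mul_inv_cancel₀ (hg.sqrt_pos q hs).ne', one_smul]

theorem unitTangent_mem_tangentLine {F : Fin M.nFacet} {q : Fin M.nElem × Fin 3}
    (hq : M.facet q = F) (s : ℝ) : M.unitTangent g q s ∈ M.tangentLine F s := by
  subst hq
  exact Submodule.smul_mem _ _ (M.velocity_mem_tangentLine _ s)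

theorem IsReggeMetric.tangent_ortho (hg : M.IsReggeMetric g) (q : Fin M.nElem × Fin 3)
    {s : ℝ} (hs : s ∈ Icc (0 : ℝ) 1) {X : Pt} (hX : X ∈ M.tangentLine (M.facet q) s) :
    ev2 (M.metricAt g q s) X (M.normal g q s) = 0 := by
  obtain ⟨c, rfl⟩ := M.mem_tangentLine.1 hX
  rw [hg.velocity_eq_smul q hs, ev2_smul_left, ev2_smul_left, hg.normal_ortho q hs, mul_zero,
    mul_zero]

theorem IsReggeMetric.contDiffOn_rTangent (hg : M.IsReggeMetric g) (q : Fin M.nElem × Fin 3) :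
    ContDiffOn ℝ ∞ (M.rTangent g q) (Icc 0 1) :=
  contDiffOn_rightTangent (hg.contDiffOn_metricAt q) (fun _ hs => hg.posDef_metricAt q hs)
    (hg.contDiffOn_normal q)

theorem IsReggeMetric.rTangent_unit (hg : M.IsReggeMetric g) (q : Fin M.nElem × Fin 3)
    {s : ℝ} (hs : s ∈ Icc (0 : ℝ) 1) :
    ev2 (M.metricAt g q s) (M.rTangent g q s) (M.rTangent g q s) = 1 :=
  rightTangent_unit (hg.posDef_metricAt q hs) (hg.normal_unit q hs)

theorem rTangent_ortho (q : Fin M.nElem × Fin 3) (s : ℝ) :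
    ev2 (M.metricAt g q s) (M.rTangent g q s) (M.normal g q s) = 0 := rightTangent_ortho _

/-- The two unit tangents agree up to sign. -/
theorem IsReggeMetric.unitTangent_eq (hg : M.IsReggeMetric g) (q : Fin M.nElem × Fin 3)
    {s : ℝ} (hs : s ∈ Icc (0 : ℝ) 1) :
    ∃ c : ℝ, c * c = 1 ∧ M.unitTangent g q s = c • M.rTangent g q s := by
  have h := eq_smul_of_ortho (hg.posDef_metricAt q hs) (hg.normal_unit q hs) (hg.normal_ortho q hs)
    (rTangent_ortho q s) (hg.rTangent_unit q hs)
  refine ⟨_, ?_, h⟩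
  have h1 := hg.unitTangent_unit q hs
  rw [h, ev2_smul_left, ev2_smul_right, hg.rTangent_unit q hs, mul_one] at h1
  exact h1

theorem coef_smul (q : Fin M.nElem × Fin 3) (s c : ℝ) (X : Pt) :
    M.coef g q s (c • X) = c * M.coef g q s X := by
  rw [coef, coef, ev2_smul_left, mul_div_assoc]

theorem IsReggeMetric.contDiffOn_coef (hg : M.IsReggeMetric g) (q : Fin M.nElem × Fin 3)
    {X : ℝ → Pt} (hX : ContDiffOn ℝ ∞ X (Icc 0 1)) :
    ContDiffOn ℝ ∞ (fun s => M.coef g q s (X s)) (Icc 0 1) :=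
  (contDiffOn_ev2 (hg.contDiffOn_metricAt q) hX (M.contDiffOn_velocity q)).div
    (contDiffOn_ev2 (hg.contDiffOn_metricAt q) (M.contDiffOn_velocity q) (M.contDiffOn_velocity q))
    fun _ hs => (posDef_ev2_pos (hg.posDef_metricAt q hs) (M.velocity_ne_zero q hs)).ne'

/-- The tangential-tangential components of the metric are the same from all sides. -/
theorem IsReggeMetric.metricAt_velocity (hg : M.IsReggeMetric g) {F : Fin M.nFacet}
    (hF : F ∈ M.intFacets) {q q' : Fin M.nElem × Fin 3} (hq : M.facet q = F) (hq' : M.facet q' = F)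
    {s : ℝ} (hs : s ∈ Icc (0 : ℝ) 1) :
    ev2 (M.metricAt g q s) (M.velocity F s) (M.velocity F s)
      = ev2 (M.metricAt g q' s) (M.velocity F s) (M.velocity F s) := by
  have h := hg.tt_continuous F hF q (M.mem_sides.2 hq) q' (M.mem_sides.2 hq') s hs _
    (M.velocity_mem_tangentLine F s) _ (M.velocity_mem_tangentLine F s)
  rw [metricAt, metricAt, hq, hq']
  exact h

theorem IsReggeMetric.unitTangent_side (hg : M.IsReggeMetric g) {F : Fin M.nFacet}
    (hF : F ∈ M.intFacets) {q q' : Fin M.nElem × Fin 3} (hq : M.facet q = F) (hq' : M.facet q' = F)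
    {s : ℝ} (hs : s ∈ Icc (0 : ℝ) 1) : M.unitTangent g q s = M.unitTangent g q' s := by
  rw [unitTangent, unitTangent, gunit, gunit, hq, hq', hg.metricAt_velocity hF hq hq' hs]

/-! ## The test tensors -/

theorem IsReggeMetric.toTensor_eq (hg : M.IsReggeMetric g) (u : M.Scal) {T : Fin M.nElem} {x : Pt}
    (hx : x ∈ M.body T) (i j k l : Fin 2) :
    M.toTensor g u T x i j k l = u T x * (g T x).det * permSym i j * permSym l k := by
  have hG := hg.posDef T x hx
  rw [toTensor, star2_wedge_flat hG, star2_wedge_flat hG, symProd]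
  linear_combination u T x * permSym i j * permSym l k * sqrt_det_mul_self hG

theorem IsReggeMetric.Atnnt_of_eq (hg : M.IsReggeMetric g) {A : M.Fld4} {u : M.Scal}
    (hA : ∀ T, ∀ x ∈ M.body T, ∀ i j k l,
      A T x i j k l = u T x * (g T x).det * permSym i j * permSym l k)
    (q : Fin M.nElem × Fin 3) {s : ℝ} (hs : s ∈ Icc (0 : ℝ) 1) {X : Pt} (Y : Pt)
    (hX : X ∈ M.tangentLine (M.facet q) s) :
    M.Atnnt g A q s X Y = u q.1 (M.curve (M.facet q) s) * ev2 (M.metricAt g q s) X Y :=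
  orthonormal_tensor (hg.posDef_metricAt q hs) (hA q.1 _ (M.curve_mem_body q hs))
    (hg.normal_unit q hs) (hg.tangent_ortho q hs hX)

theorem IsReggeMetric.Atnnt_toTensor (hg : M.IsReggeMetric g) (u : M.Scal)
    (q : Fin M.nElem × Fin 3) {s : ℝ} (hs : s ∈ Icc (0 : ℝ) 1) {X : Pt} (Y : Pt)
    (hX : X ∈ M.tangentLine (M.facet q) s) :
    M.Atnnt g (M.toTensor g u) q s X Y
      = u q.1 (M.curve (M.facet q) s) * ev2 (M.metricAt g q s) X Y :=
  hg.Atnnt_of_eq (fun _ _ hx => hg.toTensor_eq u hx) q hs Y hX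

end CurvedMesh

/-! ### Product rules along curves -/

theorem hasDerivWithinAt_coord {X : ℝ → Pt} {X' : Pt} {S : Set ℝ} {s : ℝ}
    (h : HasDerivWithinAt X X' S s) (i : Fin 2) : HasDerivWithinAt (fun r => X r i) (X' i) S s :=
  (EuclideanSpace.proj i : Pt →L[ℝ] ℝ).hasFDerivAt.comp_hasDerivWithinAt s h

theorem hasDerivWithinAt_ev2 {G : ℝ → Tens2} {G' : Tens2} {X Y : ℝ → Pt} {X' Y' : Pt} {S : Set ℝ}
    {s : ℝ} (hG : ∀ i j, HasDerivWithinAt (fun r => G r i j) (G' i j) S s)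
    (hX : HasDerivWithinAt X X' S s) (hY : HasDerivWithinAt Y Y' S s) :
    HasDerivWithinAt (fun r => ev2 (G r) (X r) (Y r))
      (ev2 G' (X s) (Y s) + ev2 (G s) X' (Y s) + ev2 (G s) (X s) Y') S s := by
  have h1 := hasDerivWithinAt_coord hX
  have h2 := hasDerivWithinAt_coord hY
  have h := HasDerivWithinAt.fun_sum (u := Finset.univ) fun (i : Fin 2) _ =>
    HasDerivWithinAt.fun_sum (u := Finset.univ) fun (j : Fin 2) _ =>
      ((hG i j).mul (h1 i)).mul (h2 j)
  refine h.congr_deriv ?_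
  simp only [ev2, Fin.sum_univ_two, Pi.mul_apply]
  ring

theorem hasDerivWithinAt_of_smooth {E : Type*} [NormedAddCommGroup E] [NormedSpace ℝ E]
    {f : ℝ → E} (hf : ContDiffOn ℝ ∞ f (Icc 0 1)) {s : ℝ} (hs : s ∈ Icc (0 : ℝ) 1) :
    HasDerivWithinAt f (derivWithin f (Icc 0 1) s) (Icc 0 1) s :=
  ((hf s hs).differentiableWithinAt (by simp)).hasDerivWithinAt

theorem eq_sum_coordVec (v : Pt) : v = ∑ i, v i • coordVec i := by
  ext i
  fin_cases i <;> simp [coordVec]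

namespace CurvedMesh

variable {Ω : Set Pt} {M : CurvedMesh Ω} {g : M.Fld2} {T : Fin M.nElem}

/-! ## Partial derivatives within an element -/

theorem differentiableWithinAt_body {f : Pt → ℝ} (hf : ContDiffOn ℝ ∞ f (M.body T)) {x : Pt}
    (hx : x ∈ M.body T) : DifferentiableWithinAt ℝ f (M.body T) x :=
  (hf x hx).differentiableWithinAt (by simp)

theorem contDiffOn_pd {f : Pt → ℝ} (hf : ContDiffOn ℝ ∞ f (M.body T)) (i : Fin 2) :
    ContDiffOn ℝ ∞ (M.pd T i f) (M.body T) :=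
  (hf.fderivWithin (M.uniqueDiffOn_body T) (by simp)).clm_apply contDiffOn_const

theorem pd_congr {f h : Pt → ℝ} (e : EqOn f h (M.body T)) (i : Fin 2) {x : Pt}
    (hx : x ∈ M.body T) : M.pd T i f x = M.pd T i h x := by
  rw [pd, pd, fderivWithin_congr e (e hx)]

theorem pd_add {f h : Pt → ℝ} (hf : ContDiffOn ℝ ∞ f (M.body T))
    (hh : ContDiffOn ℝ ∞ h (M.body T)) (i : Fin 2) {x : Pt} (hx : x ∈ M.body T) :
    M.pd T i (fun y => f y + h y) x = M.pd T i f x + M.pd T i h x := by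
  rw [pd, fderivWithin_fun_add (M.uniqueDiffOn_body T x hx) (differentiableWithinAt_body hf hx)
    (differentiableWithinAt_body hh hx)]
  rfl

theorem pd_sub {f h : Pt → ℝ} (hf : ContDiffOn ℝ ∞ f (M.body T))
    (hh : ContDiffOn ℝ ∞ h (M.body T)) (i : Fin 2) {x : Pt} (hx : x ∈ M.body T) :
    M.pd T i (fun y => f y - h y) x = M.pd T i f x - M.pd T i h x := by
  rw [pd, fderivWithin_fun_sub (M.uniqueDiffOn_body T x hx) (differentiableWithinAt_body hf hx)
    (differentiableWithinAt_body hh hx)]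
  rfl

theorem pd_mul {f h : Pt → ℝ} (hf : ContDiffOn ℝ ∞ f (M.body T))
    (hh : ContDiffOn ℝ ∞ h (M.body T)) (i : Fin 2) {x : Pt} (hx : x ∈ M.body T) :
    M.pd T i (fun y => f y * h y) x = f x * M.pd T i h x + h x * M.pd T i f x := by
  rw [pd, fderivWithin_fun_mul (M.uniqueDiffOn_body T x hx) (differentiableWithinAt_body hf hx)
    (differentiableWithinAt_body hh hx)]
  rfl

theorem pd_div_const (f : Pt → ℝ) (c : ℝ) (hf : ContDiffOn ℝ ∞ f (M.body T)) (i : Fin 2) {x : Pt}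
    (hx : x ∈ M.body T) : M.pd T i (fun y => f y / c) x = M.pd T i f x / c := by
  simp only [div_eq_mul_inv]
  rw [pd, fderivWithin_mul_const (M.uniqueDiffOn_body T x hx) (differentiableWithinAt_body hf hx)]
  simp [pd, mul_comm]

/-- Symmetry persists at boundary points because every point of the element is a limit of interior
points. -/
theorem pd_comm {f : Pt → ℝ} (hf : ContDiffOn ℝ ∞ f (M.body T)) (i j : Fin 2) {x : Pt}
    (hx : x ∈ M.body T) : M.pd T i (M.pd T j f) x = M.pd T j (M.pd T i f) x := by
  have hd : DifferentiableWithinAt ℝ (fderivWithin ℝ f (M.body T)) (M.body T) x :=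
    ((hf.fderivWithin (m := ∞) (M.uniqueDiffOn_body T) (by simp)) x hx).differentiableWithinAt
      (by simp)
  have h := (hf x hx).isSymmSndFDerivWithinAt
    (by rw [minSmoothness_of_isRCLikeNormedField]; exact ENat.LEInfty.out) (M.uniqueDiffOn_body T)
    (M.body_subset_closure_interior T hx) hx
  have e : ∀ i j, M.pd T i (M.pd T j f) x
      = fderivWithin ℝ (fderivWithin ℝ f (M.body T)) (M.body T) x (coordVec i) (coordVec j) := by
    intro i j
    have h2 := (hd.hasFDerivWithinAt.clm_apply
      (hasFDerivWithinAt_const (coordVec j) x (M.body T))).fderivWithin (M.uniqueDiffOn_body T x hx)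
    have e2 : M.pd T j f = fun y => fderivWithin ℝ f (M.body T) y (coordVec j) := rfl
    rw [pd, e2, h2]
    simp
  rw [e, e, h]

/-- The chain rule along a facet. -/
theorem hasDerivWithinAt_comp_curve {f : Pt → ℝ} (q : Fin M.nElem × Fin 3)
    (hf : ContDiffOn ℝ ∞ f (M.body q.1)) {s : ℝ} (hs : s ∈ Icc (0 : ℝ) 1) :
    HasDerivWithinAt (fun r => f (M.curve (M.facet q) r))
      (∑ l, M.velocity (M.facet q) s l * M.pd q.1 l f (M.curve (M.facet q) s)) (Icc 0 1) s := by
  have h := (differentiableWithinAt_body hf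
    (M.curve_mem_body q hs)).hasFDerivWithinAt.comp_hasDerivWithinAt s (M.curve_hasDerivWithinAt q hs) (M.mapsTo_curve q)
  refine h.congr_deriv ?_
  conv_lhs => rw [eq_sum_coordVec (M.velocity (M.facet q) s)]
  simp [pd]

/-! ## The Levi-Civita connection -/

theorem IsRegge.symm_on {σ : M.Fld2} (hσ : M.IsRegge σ) (i j : Fin 2) :
    EqOn (fun y => σ T y i j) (fun y => σ T y j i) (M.body T) :=
  fun x hx => hσ.symm T x hx i j

theorem IsReggeMetric.Γ_symm (hg : M.IsReggeMetric g) (k i j : Fin 2) {x : Pt}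
    (hx : x ∈ M.body T) : M.Γ g T k i j x = M.Γ g T k j i x := by
  unfold Γ
  refine Finset.sum_congr rfl fun l _ => ?_
  rw [pd_congr (hg.symm_on i j) l hx]
  ring

theorem IsReggeMetric.contDiffOn_Γ (hg : M.IsReggeMetric g) (k i j : Fin 2) :
    ContDiffOn ℝ ∞ (M.Γ g T k i j) (M.body T) := by
  unfold Γ
  exact ContDiffOn.sum fun l _ => ((contDiffOn_matrix_inv (hg.smooth T) (hg.posDef T) k l).mul
    (((contDiffOn_pd (hg.smooth T _ _) _).add (contDiffOn_pd (hg.smooth T _ _) _)).sub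
      (contDiffOn_pd (hg.smooth T _ _) _))).div_const _

theorem IsReggeMetric.lower_Γ (hg : M.IsReggeMetric g) (l i j : Fin 2) {x : Pt}
    (hx : x ∈ M.body T) :
    ∑ m, g T x l m * M.Γ g T m i j x = (M.pd T i (fun y => g T y j l) x
      + M.pd T j (fun y => g T y i l) x - M.pd T l (fun y => g T y i j) x) / 2 := by
  have hG := hg.posDef T x hx
  have h1 : g T x * (g T x)⁻¹ = 1 := Matrix.mul_nonsing_inv _ (Ne.isUnit hG.det_pos.ne')
  have h2 : ∀ a b, ∑ m, g T x a m * (g T x)⁻¹ m b = (1 : Tens2) a b := by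
    intro a b; rw [← h1, Matrix.mul_apply]
  have e : ∀ D : Fin 2 → ℝ, ∑ m, g T x l m * ∑ p, (g T x)⁻¹ m p * D p / 2 = D l / 2 := by
    intro D
    have h3 := h2 l 0
    have h4 := h2 l 1
    simp only [Fin.sum_univ_two] at h3 h4 ⊢
    have h5 : ∀ a, D a = (1 : Tens2) a 0 * D 0 + (1 : Tens2) a 1 * D 1 :=
      Fin.forall_fin_two.2 ⟨by simp, by simp⟩
    rw [h5 l, ← h3, ← h4]
    ring
  exact e fun l => _

/-- The metric is parallel. -/
theorem IsReggeMetric.pd_metric (hg : M.IsReggeMetric g) (k i j : Fin 2) {x : Pt}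
    (hx : x ∈ M.body T) :
    M.pd T k (fun y => g T y i j) x
      = ∑ m, (g T x i m * M.Γ g T m k j x + g T x j m * M.Γ g T m k i x) := by
  rw [Finset.sum_add_distrib, hg.lower_Γ i k j hx, hg.lower_Γ j k i hx,
    pd_congr (hg.symm_on j i) k hx, pd_congr (hg.symm_on k i) j hx,
    pd_congr (hg.symm_on k j) i hx]
  ring

theorem IsReggeMetric.contDiffOn_cov (hg : M.IsReggeMetric g) {σ : M.Fld2} (hσ : M.IsRegge σ)
    (k i j : Fin 2) : ContDiffOn ℝ ∞ (fun x => M.cov g σ T x k i j) (M.body T) := by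
  unfold cov
  exact (contDiffOn_pd (hσ.smooth T _ _) _).sub (ContDiffOn.sum fun m _ =>
    ((hg.contDiffOn_Γ _ _ _).mul (hσ.smooth T _ _)).add
      ((hg.contDiffOn_Γ _ _ _).mul (hσ.smooth T _ _)))

/-! ## Covariant derivatives along facets -/

/-- The covariant derivative of a vector field along a facet in the direction of the velocity. -/
def curveCov (M : CurvedMesh Ω) (g : M.Fld2) (q : Fin M.nElem × Fin 3) (V : ℝ → Pt) (s : ℝ) : Pt :=
  derivWithin V (Icc 0 1) s + ∑ m, (∑ l, ∑ j,
    M.Γ g q.1 m l j (M.curve (M.facet q) s) * M.velocity (M.facet q) s l * V s j) • coordVec m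

theorem facetCovVec_eq (q : Fin M.nElem × Fin 3) (V : ℝ → Pt) (s : ℝ) (X : Pt) :
    M.facetCovVec g q V s X = M.coef g q s X • M.curveCov g q V s := rfl

theorem curveCov_apply (q : Fin M.nElem × Fin 3) (V : ℝ → Pt) (s : ℝ) (i : Fin 2) :
    M.curveCov g q V s i = derivWithin V (Icc 0 1) s i + ∑ l, ∑ j,
      M.Γ g q.1 i l j (M.curve (M.facet q) s) * M.velocity (M.facet q) s l * V s j := by
  fin_cases i <;> simp [curveCov, coordVec]

/-- Metric compatibility along a facet. -/
theorem IsReggeMetric.hasDerivWithinAt_metric (hg : M.IsReggeMetric g) (q : Fin M.nElem × Fin 3)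
    {X Y : ℝ → Pt} (hX : ContDiffOn ℝ ∞ X (Icc 0 1)) (hY : ContDiffOn ℝ ∞ Y (Icc 0 1)) {s : ℝ}
    (hs : s ∈ Icc (0 : ℝ) 1) :
    HasDerivWithinAt (fun r => ev2 (M.metricAt g q r) (X r) (Y r))
      (ev2 (M.metricAt g q s) (M.curveCov g q X s) (Y s)
        + ev2 (M.metricAt g q s) (X s) (M.curveCov g q Y s)) (Icc 0 1) s := by
  have hx := M.curve_mem_body q hs
  have h := hasDerivWithinAt_ev2 (G := fun r => M.metricAt g q r)
    (G' := Matrix.of fun i j => ∑ l, M.velocity (M.facet q) s l *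
      M.pd q.1 l (fun y => g q.1 y i j) (M.curve (M.facet q) s))
    (fun i j => hasDerivWithinAt_comp_curve q (hg.smooth q.1 i j) hs)
    (hasDerivWithinAt_of_smooth hX hs) (hasDerivWithinAt_of_smooth hY hs)
  refine h.congr_deriv ?_
  simp only [ev2, Matrix.of_apply, hg.pd_metric _ _ _ hx, curveCov_apply, Fin.sum_univ_two,
    metricAt, hg.symm q.1 _ hx 1 0]
  ring

/-- Two orthogonal fields along a facet. -/
theorem IsReggeMetric.curveCov_ortho (hg : M.IsReggeMetric g) (q : Fin M.nElem × Fin 3)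
    {X Y : ℝ → Pt} (hX : ContDiffOn ℝ ∞ X (Icc 0 1)) (hY : ContDiffOn ℝ ∞ Y (Icc 0 1)) {c : ℝ}
    (hc : ∀ s ∈ Icc (0 : ℝ) 1, ev2 (M.metricAt g q s) (X s) (Y s) = c) {s : ℝ}
    (hs : s ∈ Icc (0 : ℝ) 1) :
    ev2 (M.metricAt g q s) (M.curveCov g q X s) (Y s)
        + ev2 (M.metricAt g q s) (X s) (M.curveCov g q Y s) = 0 := by
  have h := hg.hasDerivWithinAt_metric q hX hY hs
  have h2 : HasDerivWithinAt (fun r => ev2 (M.metricAt g q r) (X r) (Y r)) 0 (Icc 0 1) s :=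
    (hasDerivWithinAt_const s (Icc 0 1) c).congr hc (hc s hs)
  exact (uniqueDiffOn_unitInterval s hs).eq_deriv _ h h2

/-- The Leibniz rule for the covector `σ(N, ·)` applied to `Y`: the ordinary derivative of `Y` and
the Christoffel terms combine to its covariant derivative. -/
theorem facetCovForm_eq {σ : M.Fld2} (hσ : M.IsRegge σ) (q : Fin M.nElem × Fin 3)
    {N Y : ℝ → Pt} (hN : ContDiffOn ℝ ∞ N (Icc 0 1)) (hY : ContDiffOn ℝ ∞ Y (Icc 0 1)) {s : ℝ}
    (hs : s ∈ Icc (0 : ℝ) 1) (X : Pt) :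
    M.facetCovForm g q (fun r j => ∑ i, σ q.1 (M.curve (M.facet q) r) i j * N r i) s X (Y s)
      = M.facetDeriv g q (fun r => ev2 (σ q.1 (M.curve (M.facet q) r)) (N r) (Y r)) s X
        - M.coef g q s X *
          ev2 (σ q.1 (M.curve (M.facet q) s)) (N s) (M.curveCov g q Y s) := by
  have hα : ∀ j, ContDiffOn ℝ ∞
      (fun r => ∑ i, σ q.1 (M.curve (M.facet q) r) i j * N r i) (Icc 0 1) := fun j =>
    ContDiffOn.sum fun i _ => (hσ.contDiffOn_curve q i j).mul (contDiffOn_euclidean.1 hN i)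
  have h := HasDerivWithinAt.fun_sum (u := Finset.univ) fun (j : Fin 2) _ =>
    (hasDerivWithinAt_of_smooth (hα j) hs).mul
      (hasDerivWithinAt_coord (hasDerivWithinAt_of_smooth hY hs) j)
  have e : (fun r => ev2 (σ q.1 (M.curve (M.facet q) r)) (N r) (Y r))
      = fun r => ∑ j, (fun r => ∑ i, σ q.1 (M.curve (M.facet q) r) i j * N r i) r
        * Y r j := by
    funext r
    simp only [ev2, Fin.sum_univ_two]
    ring
  rw [facetCovForm, facetDeriv, e]
  erw [h.derivWithin (uniqueDiffOn_unitInterval s hs)]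
  simp only [ev2, curveCov_apply, Fin.sum_univ_two]
  ring

end CurvedMesh

/-! ### Symmetry and multilinearity of contractions -/

theorem inner4_swap23 (G : Tens2) (A B : Tens4) :
    inner4 G A (swap23 B) = inner4 G (swap23 A) B := by
  unfold inner4 swap23
  refine Finset.sum_congr rfl fun i _ => ?_
  rw [Finset.sum_comm]
  refine Finset.sum_congr rfl fun j _ => Finset.sum_congr rfl fun k _ =>
    Finset.sum_congr rfl fun l _ => Finset.sum_congr rfl fun p _ => ?_
  rw [Finset.sum_comm]
  refine Finset.sum_congr rfl fun q _ => Finset.sum_congr rfl fun r _ =>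
    Finset.sum_congr rfl fun s _ => ?_
  ring

theorem ev3_smul_left (B : Tens3) (c : ℝ) (X Y Z : Pt) :
    ev3 B (c • X) Y Z = c * ev3 B X Y Z := by
  simp [ev3, Fin.sum_univ_two]; ring

theorem ev3_smul_middle (B : Tens3) (c : ℝ) (X Y Z : Pt) :
    ev3 B X (c • Y) Z = c * ev3 B X Y Z := by
  simp [ev3, Fin.sum_univ_two]; ring

theorem ev3_smul_right (B : Tens3) (c : ℝ) (X Y Z : Pt) :
    ev3 B X Y (c • Z) = c * ev3 B X Y Z := by
  simp [ev3, Fin.sum_univ_two]; ring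

namespace CurvedMesh

variable {Ω : Set Pt} {M : CurvedMesh Ω} {g : M.Fld2} {T : Fin M.nElem}

/-! ## Curvature -/

/-- The derivative of `lower_Γ`. It trades derivatives of Christoffel symbols for second derivatives
of the metric. -/
theorem IsReggeMetric.lower_pd_Γ (hg : M.IsReggeMetric g) (i j k l : Fin 2) {x : Pt}
    (hx : x ∈ M.body T) :
    ∑ m, (g T x l m * M.pd T i (M.Γ g T m j k) x
        + M.Γ g T m j k x * M.pd T i (fun y => g T y l m) x)
      = (M.pd T i (M.pd T j fun y => g T y k l) x + M.pd T i (M.pd T k fun y => g T y j l) x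
        - M.pd T i (M.pd T l fun y => g T y j k) x) / 2 := by
  have hs := hg.smooth T
  have h1 : M.pd T i (fun y => ∑ m, g T y l m * M.Γ g T m j k y) x
      = M.pd T i (fun y => (M.pd T j (fun z => g T z k l) y + M.pd T k (fun z => g T z j l) y
          - M.pd T l (fun z => g T z j k) y) / 2) x :=
    pd_congr (fun y hy => hg.lower_Γ l j k hy) i hx
  rw [pd_div_const _ _ (((contDiffOn_pd (hs k l) j).add (contDiffOn_pd (hs j l) k)).sub
      (contDiffOn_pd (hs j k) l)) i hx, pd_sub ((contDiffOn_pd (hs k l) j).add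
      (contDiffOn_pd (hs j l) k)) (contDiffOn_pd (hs j k) l) i hx,
    pd_add (contDiffOn_pd (hs k l) j) (contDiffOn_pd (hs j l) k) i hx] at h1
  rw [← h1]
  simp only [Fin.sum_univ_two]
  rw [pd_add ((hs l 0).mul (hg.contDiffOn_Γ 0 j k)) ((hs l 1).mul (hg.contDiffOn_Γ 1 j k)) i hx,
    pd_mul (hs l 0) (hg.contDiffOn_Γ 0 j k) i hx, pd_mul (hs l 1) (hg.contDiffOn_Γ 1 j k) i hx]

theorem riemann_skew_left (x : Pt) (i j k l : Fin 2) :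
    M.riemann g T x i j k l = -M.riemann g T x j i k l := by
  simp only [riemann, Fin.sum_univ_two]; ring

/-- The form of the fully covariant curvature in which skewness in the last pair is visible. The
derivatives `∂_i ∂_j g_kl` drop out because partial derivatives commute. -/
theorem IsReggeMetric.riemann_eq (hg : M.IsReggeMetric g) (i j k l : Fin 2) {x : Pt}
    (hx : x ∈ M.body T) :
    M.riemann g T x i j k l
      = (M.pd T i (M.pd T k fun y => g T y j l) x - M.pd T i (M.pd T l fun y => g T y j k) x
          - M.pd T j (M.pd T k fun y => g T y i l) x + M.pd T j (M.pd T l fun y => g T y i k) x) / 2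
        - ∑ m, ∑ p, g T x m p * (M.Γ g T m j k x * M.Γ g T p i l x
            - M.Γ g T m i k x * M.Γ g T p j l x) := by
  have h1 := hg.lower_pd_Γ i j k l hx
  have h2 := hg.lower_pd_Γ j i k l hx
  have h3 := pd_comm (hg.smooth T k l) i j hx
  have hp := fun a b c => hg.pd_metric a b c hx
  have hs := hg.symm T x hx 1 0
  simp only [hp, Fin.sum_univ_two] at h1 h2
  simp only [riemann, Fin.sum_univ_two]
  simp only [hs] at h1 h2 ⊢
  linear_combination h1 - h2 + h3 / 2

theorem IsReggeMetric.riemann_skew_right (hg : M.IsReggeMetric g) (i j k l : Fin 2) {x : Pt}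
    (hx : x ∈ M.body T) : M.riemann g T x i j k l = -M.riemann g T x i j l k := by
  rw [hg.riemann_eq i j k l hx, hg.riemann_eq i j l k hx]
  have hs := hg.symm T x hx 1 0
  simp only [Fin.sum_univ_two, hs]
  ring

theorem IsReggeMetric.inner4_toTensor (hg : M.IsReggeMetric g) (u : M.Scal) (B : Tens4) {x : Pt}
    (hx : x ∈ M.body T) :
    inner4 (g T x) B (M.toTensor g u T x)
      = u T x / (g T x).det * ∑ i, ∑ j, ∑ k, ∑ l, B i j k l * permSym i j * permSym l k :=
  inner4_perm (hg.posDef T x hx) _ _ _ (hg.toTensor_eq u hx)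

/-- Four index combinations survive the antisymmetrization, each contributing `R₀₁₁₀`; hence the
factor 4. -/
theorem IsReggeMetric.inner4_riemann (hg : M.IsReggeMetric g) (u : M.Scal) {x : Pt}
    (hx : x ∈ M.body T) :
    inner4 (g T x) (M.riemann g T x) (M.toTensor g u T x) = 4 * (M.gauss g T x * u T x) := by
  rw [hg.inner4_toTensor u _ hx, gauss]
  have h1 := hg.riemann_skew_right 0 1 0 1 hx
  have h2 := riemann_skew_left (M := M) (g := g) (T := T) x 1 0 0 1
  have h3 := riemann_skew_left (M := M) (g := g) (T := T) x 1 0 1 0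
  simp [Fin.sum_univ_two, permSym, h1, h2, h3]
  ring

/-- For a 2-form `β` in the plane, antisymmetrizing `β(L·, ·)` gives `tr L / 2` times the
antisymmetrization of `β`. Only skewness in the first pair is needed. -/
theorem IsReggeMetric.inner4_Lfirst (hg : M.IsReggeMetric g) (σ : Tens2) (u : M.Scal) {x : Pt}
    (hx : x ∈ M.body T) :
    inner4 (g T x) (Lfirst (g T x) σ (M.riemann g T x)) (M.toTensor g u T x)
      - gtrace (g T x) σ / 2 * inner4 (g T x) (M.riemann g T x) (M.toTensor g u T x) = 0 := by
  rw [hg.inner4_toTensor u _ hx, hg.inner4_toTensor u _ hx]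
  have h2 := fun k l => riemann_skew_left (M := M) (g := g) (T := T) x 1 0 k l
  have h3 : ∀ a k l, M.riemann g T x a a k l = 0 := by
    intro a k l
    linarith [riemann_skew_left (M := M) (g := g) (T := T) x a a k l]
  simp [Fin.sum_univ_two, permSym, Lfirst, Lmap, gtrace, h2, h3]
  ring

/-! ## The incompatibility operator -/

theorem IsReggeMetric.pd_cov (hg : M.IsReggeMetric g) {σ : M.Fld2} (hσ : M.IsRegge σ)
    (q j i k : Fin 2) {x : Pt} (hx : x ∈ M.body T) :
    M.pd T q (fun y => M.cov g σ T y j i k) x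
      = M.pd T q (M.pd T j fun y => σ T y i k) x
        - M.pd T q (fun y => ∑ m, M.Γ g T m j i y * σ T y m k) x
        - M.pd T q (fun y => ∑ m, M.Γ g T m j k y * σ T y i m) x := by
  have h1 := contDiffOn_pd (hσ.smooth T i k) j
  have h2 : ContDiffOn ℝ ∞ (fun y => ∑ m, M.Γ g T m j i y * σ T y m k) (M.body T) :=
    ContDiffOn.sum fun m _ => (hg.contDiffOn_Γ _ _ _).mul (hσ.smooth T _ _)
  have h3 : ContDiffOn ℝ ∞ (fun y => ∑ m, M.Γ g T m j k y * σ T y i m) (M.body T) :=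
    ContDiffOn.sum fun m _ => (hg.contDiffOn_Γ _ _ _).mul (hσ.smooth T _ _)
  rw [← pd_sub h1 h2 q hx, ← pd_sub (h1.sub h2) h3 q hx]
  simp only [cov, Finset.sum_add_distrib, sub_add_eq_sub_sub]

/-- Christoffel terms whose lower indices are antisymmetrized vanish. The two remaining outer
corrections act as an endomorphism on a 2-form and so reduce to the trace `Γ^l_{lq}` in `inc`. The
minus sign comes from the order `l k` in the second permutation symbol. -/
theorem IsReggeMetric.inner4_cov2 (hg : M.IsReggeMetric g) {σ : M.Fld2} (hσ : M.IsRegge σ)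
    (u : M.Scal) {x : Pt} (hx : x ∈ M.body T) :
    inner4 (g T x) (M.cov2 g σ T x) (swap23 (M.toTensor g u T x))
      = -(M.inc g σ T x * u T x) := by
  have hd := sqrt_det_mul_self (hg.posDef T x hx)
  have hd0 := (hg.posDef T x hx).det_pos.ne'
  have hr0 : Real.sqrt (g T x).det ≠ 0 := (Real.sqrt_pos.2 (hg.posDef T x hx).det_pos).ne'
  have he : ∀ q i j k, epsHat (g T x) q i * epsHat (g T x) j k
      = permSym q i * permSym j k / (g T x).det := by
    intro q i j k
    rw [← hd, epsHat, epsHat, div_mul_div_comm]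
  have hΓ := fun k => hg.Γ_symm (T := T) k 1 0 hx
  -- Symmetry of `Γ` is also needed under the derivative: the term `Γ^m_{jk} σ_{im}`, absent from
  -- `inc`, has to cancel there.
  have hQ : ∀ q i, M.pd T q (fun y => ∑ m, M.Γ g T m 1 0 y * σ T y i m) x
      = M.pd T q (fun y => ∑ m, M.Γ g T m 0 1 y * σ T y i m) x := fun q i =>
    pd_congr (fun y hy => by simp only [fun k => hg.Γ_symm (T := T) k 1 0 hy]) q hx
  rw [inner4_swap23, hg.inner4_toTensor u _ hx]
  simp only [inc, he, swap23, cov2, hg.pd_cov hσ _ _ _ _ hx]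
  simp [permSym, Fin.sum_univ_two]
  simp only [Fin.sum_univ_two] at hQ
  simp only [hQ, cov, Fin.sum_univ_two, hΓ]
  ring

/-! ## Facet terms -/

/-- Differentiate `g(t, n) = 0` along the facet. -/
theorem IsReggeMetric.sff_unitTangent (hg : M.IsReggeMetric g) (q : Fin M.nElem × Fin 3) {s : ℝ}
    (hs : s ∈ Icc (0 : ℝ) 1) :
    M.sff g q s (M.unitTangent g q s) (M.unitTangent g q s) = M.geodCurv g q s := by
  have h := hg.curveCov_ortho q (hg.contDiffOn_unitTangent q) (hg.contDiffOn_normal q)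
    (fun s hs => hg.normal_ortho q hs) hs
  rw [sff, geodCurv, facetCovVec_eq, facetCovVec_eq, ev2_smul_left, ev2_smul_left,
    ev2_comm (posDef_symm (hg.posDef_metricAt q hs)) (M.curveCov g q (M.normal g q) s)]
  linear_combination -M.coef g q s (M.unitTangent g q s) * h

/-- Being quadratic, the facet term does not see the orientation of the tangent, so the
parametrization tangent may be replaced by the right-handed one. -/
theorem bFacetTensor_smul (σ : M.Fld2) (q : Fin M.nElem × Fin 3) (s c : ℝ) (X : Pt) :
    M.bFacetTensor g σ q s (c • X) (c • X) = c * c * M.bFacetTensor g σ q s X X := by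
  simp only [bFacetTensor, sff, facetCovVec_eq, facetCovForm, coef_smul, ev2_smul_left,
    ev2_smul_right, ev3_smul_left, ev3_smul_middle, ev3_smul_right, Fin.sum_univ_two,
    PiLp.smul_apply, smul_eq_mul]
  ring

/-- Constant length forces the derivative of the tangent to be normal; differentiating `g(t, n) = 0`
gives the coefficient. -/
theorem IsReggeMetric.curveCov_rTangent (hg : M.IsReggeMetric g) (q : Fin M.nElem × Fin 3) {s : ℝ}
    (hs : s ∈ Icc (0 : ℝ) 1) :
    M.curveCov g q (M.rTangent g q) s
      = (-ev2 (M.metricAt g q s) (M.curveCov g q (M.normal g q) s) (M.rTangent g q s))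
        • M.normal g q s := by
  have hG := hg.posDef_metricAt q hs
  have h1 := hg.curveCov_ortho q (hg.contDiffOn_rTangent q) (hg.contDiffOn_rTangent q)
    (fun s hs => hg.rTangent_unit q hs) hs
  have h2 := hg.curveCov_ortho q (hg.contDiffOn_rTangent q) (hg.contDiffOn_normal q)
    (fun s _ => rTangent_ortho q s) hs
  rw [ev2_comm (posDef_symm hG) (M.rTangent g q s)] at h1 h2
  rw [← eq_neg_of_add_eq_zero_left h2]
  exact eq_smul_of_ortho hG (hg.rTangent_unit q hs) (by linarith)
    (by rw [ev2_comm (posDef_symm hG), rTangent_ortho]) (hg.normal_unit q hs)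

/-- The Leibniz correction `-σ(n, ∇_t t)` cancels `σ(n, n) II(t, t)`, and the two `∇σ` terms form
the curl. -/
theorem IsReggeMetric.bFacetTensor_unitTangent (hg : M.IsReggeMetric g) {σ : M.Fld2}
    (hσ : M.IsRegge σ) (q : Fin M.nElem × Fin 3) {s : ℝ} (hs : s ∈ Icc (0 : ℝ) 1) :
    M.bFacetTensor g σ q s (M.unitTangent g q s) (M.unitTangent g q s) = M.curlTerm g σ q s := by
  obtain ⟨c, hc, h⟩ := hg.unitTangent_eq q hs
  rw [h, bFacetTensor_smul, hc, one_mul, bFacetTensor,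
    facetCovForm_eq hσ q (hg.contDiffOn_normal q) (hg.contDiffOn_rTangent q) hs,
    hg.curveCov_rTangent q hs, sff, facetCovVec_eq, ev2_smul_left, ev2_smul_right, curlTerm, curl]
  change _ = ev3 (M.cov g σ q.1 (M.curve (M.facet q) s)) (M.rTangent g q s) _ _
    - ev3 (M.cov g σ q.1 (M.curve (M.facet q) s)) _ (M.rTangent g q s) _ + _
  ring

theorem IsReggeMetric.contDiffOn_curlTerm (hg : M.IsReggeMetric g) {σ : M.Fld2}
    (hσ : M.IsRegge σ) (q : Fin M.nElem × Fin 3) :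
    ContDiffOn ℝ ∞ (M.curlTerm g σ q) (Icc 0 1) := by
  have hn := hg.contDiffOn_normal q
  have ht := hg.contDiffOn_rTangent q
  have hc : ∀ i j k, ContDiffOn ℝ ∞ (fun s => M.cov g σ q.1 (M.curve (M.facet q) s) i j k)
      (Icc 0 1) := fun i j k =>
    (hg.contDiffOn_cov hσ i j k).comp (M.contDiffOn_curve q) (M.mapsTo_curve q)
  exact ((contDiffOn_ev3 hc ht hn ht).sub (contDiffOn_ev3 hc hn ht ht)).add
    ((hg.contDiffOn_coef q ht).mul (contDiffOn_derivWithin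
      (contDiffOn_ev2 (hσ.contDiffOn_curve q) hn ht)))

end CurvedMesh

/-! ### Punctured discs and faces of the reference triangle -/

/-- Polar coordinates: the set is a continuous image of the unit circle times an interval. -/
theorem isPreconnected_punctured_ball (x : Pt) (r : ℝ) :
    IsPreconnected (Metric.ball x r \ {x}) := by
  have h1 : IsPreconnected (Metric.sphere (0 : Pt) 1) :=
    isPreconnected_sphere (by rw [← Module.finrank_eq_rank, finrank_euclideanSpace]; norm_num) 0 1
  have h2 := (h1.prod (isPreconnected_Ioo (a := (0 : ℝ)) (b := r))).image
    (fun p : Pt × ℝ => x + p.2 • p.1) (by fun_prop)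
  convert! h2 using 1
  ext y
  constructor
  · rintro ⟨hy, hne⟩
    have hn : 0 < ‖y - x‖ := norm_pos_iff.2 (sub_ne_zero.2 hne)
    refine ⟨(‖y - x‖⁻¹ • (y - x), ‖y - x‖), ⟨?_, hn, by rwa [← dist_eq_norm]⟩, ?_⟩
    · simp [norm_smul, hn.ne']
    · simp [smul_smul, hn.ne']
  · rintro ⟨⟨v, t⟩, ⟨hv, ht⟩, rfl⟩
    have hv' : ‖v‖ = 1 := by simpa using hv
    have hv0 : v ≠ 0 := by rintro rfl; simp at hv'
    refine ⟨?_, ?_⟩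
    · simpa [norm_smul, hv', abs_of_pos ht.1] using ht.2
    · simpa [hv0] using ht.1.ne'

theorem exists_ne_mem_of_closure_interior {S : Set Pt} {x : Pt} (hx : x ∈ closure (interior S))
    {r : ℝ} (hr : 0 < r) : ∃ y ∈ S, y ∈ Metric.ball x r \ {x} := by
  obtain ⟨z, hz1, hz2⟩ := mem_closure_iff.1 hx _ Metric.isOpen_ball (Metric.mem_ball_self hr)
  have hO : Metric.ball x r ∩ interior S ∈ nhds z :=
    (Metric.isOpen_ball.inter isOpen_interior).mem_nhds ⟨hz1, hz2⟩
  obtain ⟨y, hy, hne⟩ := (infinite_of_mem_nhds z hO).nontrivial.exists_ne x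
  exact ⟨y, interior_subset hy.2, hy.1, hne⟩

theorem image_refEdge (k : Fin 3) :
    refEdge k '' Icc 0 1 = convexHull ℝ (refVert '' ({k + 1, k + 2} : Finset (Fin 3))) := by
  rw [Finset.coe_pair, image_pair, convexHull_pair, segment_eq_image]
  rfl

theorem face_cases : ∀ a : Finset (Fin 3), a ≠ Finset.univ →
    (∃ i, a ⊆ {i}) ∨ ∃ k, a = {k + 1, k + 2} := by decide

namespace CurvedMesh

variable {Ω : Set Pt} {M : CurvedMesh Ω} {g : M.Fld2} {T : Fin M.nElem}

/-! ## Intersections of elements -/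

theorem image_curve (q : Fin M.nElem × Fin 3) :
    M.curve (M.facet q) '' Icc 0 1
      = M.chart q.1 '' convexHull ℝ (refVert '' ({q.2 + 1, q.2 + 2} : Finset (Fin 3))) := by
  rw [← image_refEdge]
  conv_rhs => rw [← (M.reparam_bijOn q.1 q.2).image_eq]
  rw [image_image, image_image]
  exact image_congr fun s hs => M.curve_eq q hs

theorem face_subsingleton {a : Finset (Fin 3)} {i : Fin 3} (ha : a ⊆ {i}) :
    (M.chart T '' convexHull ℝ (refVert '' a)).Subsingleton := by
  have h : convexHull ℝ (refVert '' (a : Set (Fin 3))) ⊆ {refVert i} := by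
    rw [← convexHull_singleton (𝕜 := ℝ) (refVert i)]
    refine convexHull_mono ?_
    rintro _ ⟨j, hj, rfl⟩
    rw [Finset.mem_singleton.1 (ha hj)]
    rfl
  exact (subsingleton_singleton.anti h).image _

theorem mem_intFacets_of_mem (hΩ : IsOpen Ω) {F : Fin M.nFacet} {x : Pt} (hx : x ∈ Ω)
    (hxF : x ∈ M.curve F '' Icc 0 1) : F ∈ M.intFacets := by
  rw [mem_intFacets]
  intro h
  exact (hΩ.inter_frontier_eq.subset ⟨hx, h hxF⟩)

/-- Two elements meet at a point of `Ω` along a facet or in that point only. -/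
theorem inter_cases (hΩ : IsOpen Ω) {T' : Fin M.nElem} (hT : T ≠ T') {x : Pt} (hx : x ∈ Ω)
    (h : x ∈ M.body T) (h' : x ∈ M.body T') :
    (∃ F ∈ M.intFacets, ∃ q ∈ M.sides F, ∃ q' ∈ M.sides F, q.1 = T ∧ q'.1 = T' ∧
      ∃ s ∈ Icc (0 : ℝ) 1, M.curve F s = x) ∨ M.body T ∩ M.body T' ⊆ {x} := by
  obtain ⟨a, a', ha, ha', e, e'⟩ := M.conforming T T' hT
  rcases face_cases a ha with ⟨i, hi⟩ | ⟨k, rfl⟩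
  · right
    intro y hy
    exact (e ▸ face_subsingleton hi : (M.body T ∩ M.body T').Subsingleton) hy ⟨h, h'⟩
  rcases face_cases a' ha' with ⟨i, hi⟩ | ⟨k', rfl⟩
  · right
    intro y hy
    exact (e' ▸ face_subsingleton hi : (M.body T ∩ M.body T').Subsingleton) hy ⟨h, h'⟩
  left
  have h1 := image_curve (M := M) (T, k)
  have h2 := image_curve (M := M) (T', k')
  have hF : M.facet (T', k') = M.facet (T, k) :=
    M.facet_injective _ _ (by rw [h1, h2, ← e, ← e'])
  have hxF : x ∈ M.curve (M.facet (T, k)) '' Icc 0 1 := by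
    rw [h1, ← e]; exact ⟨h, h'⟩
  exact ⟨_, mem_intFacets_of_mem hΩ hx hxF, (T, k), M.mem_sides.2 rfl, (T', k'), M.mem_sides.2 hF,
    rfl, rfl, hxF⟩

/-- A piecewise defined function that is single-valued on interior facets is single-valued on
`Ω`. -/
theorem eq_of_facets (hΩ : IsOpen Ω) {u : M.Scal}
    (hu : ∀ F ∈ M.intFacets, ∀ q ∈ M.sides F, ∀ q' ∈ M.sides F, ∀ s ∈ Icc (0 : ℝ) 1,
      u q.1 (M.curve F s) = u q'.1 (M.curve F s))
    (T T' : Fin M.nElem) (x : Pt) (hx : x ∈ Ω) (h : x ∈ M.body T) (h' : x ∈ M.body T') :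
    u T x = u T' x := by
  by_contra hne
  have hcl : ∀ T, IsClosed (M.body T) := fun T => (M.isCompact_body T).isClosed
  -- Near `x` only the elements that contain `x` are met.
  have hN : Ω ∩ ⋂ S ∈ {S | x ∉ M.body S}, (M.body S)ᶜ ∈ nhds x :=
    (hΩ.inter ((toFinite _).isOpen_biInter fun S _ => (hcl S).isOpen_compl)).mem_nhds
      ⟨hx, mem_iInter₂.2 fun S hS => hS⟩
  obtain ⟨r, hr, hball⟩ := Metric.mem_nhds_iff.1 hN
  set P : Set (Fin M.nElem) := {S | x ∈ M.body S ∧ u S x = u T x}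
  set Q : Set (Fin M.nElem) := {S | x ∈ M.body S ∧ u S x ≠ u T x}
  -- The elements at `x` are split by whether `u` takes the value from `T` there. If both classes
  -- occur, connectedness yields a common point other than `x`, hence two elements sharing an
  -- interior facet through `x`, on which their values agree.
  have key := isPreconnected_closed_iff.1 (isPreconnected_punctured_ball x r)
    (⋃ S ∈ P, M.body S) (⋃ S ∈ Q, M.body S)
    ((toFinite P).isClosed_biUnion fun S _ => hcl S)
    ((toFinite Q).isClosed_biUnion fun S _ => hcl S) ?_ ?_ ?_
  · obtain ⟨y, hy, hyP, hyQ⟩ := key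
    obtain ⟨S, hS, hyS⟩ := mem_iUnion₂.1 hyP
    obtain ⟨S', hS', hyS'⟩ := mem_iUnion₂.1 hyQ
    have hSS' : S ≠ S' := by rintro rfl; exact hS'.2 hS.2
    rcases inter_cases hΩ hSS' hx hS.1 hS'.1 with ⟨F, hF, q, hq, q', hq', rfl, rfl, s, hs, rfl⟩ | h0
    · exact hS'.2 ((hu F hF q' hq' q hq s hs).trans hS.2)
    · exact hy.2 (h0 ⟨hyS, hyS'⟩)
  · intro y hy
    have hyN := hball hy.1
    have hyc : y ∈ ⋃ S, M.chart S '' refTri := M.covers ▸ subset_closure hyN.1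
    obtain ⟨S, hS⟩ := mem_iUnion.1 hyc
    have hxS : x ∈ M.body S := by
      by_contra hxS
      exact mem_iInter₂.1 hyN.2 S hxS hS
    by_cases hS' : u S x = u T x
    · exact Or.inl (mem_iUnion₂.2 ⟨S, ⟨hxS, hS'⟩, hS⟩)
    · exact Or.inr (mem_iUnion₂.2 ⟨S, ⟨hxS, hS'⟩, hS⟩)
  · obtain ⟨y, hy, hyb⟩ := exists_ne_mem_of_closure_interior
      (M.body_subset_closure_interior T h) hr
    exact ⟨y, hyb, mem_iUnion₂.2 ⟨T, ⟨h, rfl⟩, hy⟩⟩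
  · obtain ⟨y, hy, hyb⟩ := exists_ne_mem_of_closure_interior
      (M.body_subset_closure_interior T' h') hr
    exact ⟨y, hyb, mem_iUnion₂.2 ⟨T', ⟨h', fun e => hne e.symm⟩, hy⟩⟩

/-- Conversely, functions that are continuous on `Ω` are single-valued on the whole of the interior
facets. -/
theorem IsTestFun.eq_on_facet {u : M.Scal} (hu : M.IsTestFun u) {F : Fin M.nFacet}
    (hF : F ∈ M.intFacets) {q q' : Fin M.nElem × Fin 3} (hq : M.facet q = F) (hq' : M.facet q' = F)
    {s : ℝ} (hs : s ∈ Icc (0 : ℝ) 1) : u q.1 (M.curve F s) = u q'.1 (M.curve F s) := by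
  have hc : ∀ q, M.facet q = F → ContinuousOn (fun s => u q.1 (M.curve F s)) (Icc 0 1) := by
    rintro q rfl
    exact (hu.smooth q.1).continuousOn.comp (M.contDiffOn_curve q).continuousOn (M.mapsTo_curve q)
  -- End points of an interior facet may lie on `∂Ω`, where continuity on `Ω` says nothing; they are
  -- reached as limits from the open arc.
  have h0 : EqOn (fun s => u q.1 (M.curve F s)) (fun s => u q'.1 (M.curve F s)) (Ioo 0 1) := by
    intro r hr
    have hrI := Ioo_subset_Icc_self hr
    refine hu.continuous _ _ _ ((M.facet_interior F (M.mem_intFacets.1 hF)).1 r hr) ?_ ?_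
    · rw [← hq]; exact M.curve_mem_body q hrI
    · rw [← hq']; exact M.curve_mem_body q' hrI
  exact h0.of_subset_closure (hc q hq) (hc q' hq') Ioo_subset_Icc_self
    (closure_Ioo (zero_ne_one' ℝ)).ge hs

/-! ## Vertices -/

/-- A continuous injection of an interval is strictly monotone, so a bijection of `[0, 1]` fixes or
exchanges the end points. -/
theorem reparam_ends (T : Fin M.nElem) (k : Fin 3) :
    (M.reparam T k 0 = 0 ∧ M.reparam T k 1 = 1) ∨ (M.reparam T k 0 = 1 ∧ M.reparam T k 1 = 0) := by
  have hb := M.reparam_bijOn T k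
  have m0 : (0 : ℝ) ∈ Icc (0 : ℝ) 1 := by simp
  have m1 : (1 : ℝ) ∈ Icc (0 : ℝ) 1 := by simp
  obtain ⟨a, ha, ea⟩ := hb.surjOn m0
  obtain ⟨b, hb', eb⟩ := hb.surjOn m1
  rcases (M.reparam_smooth T k).continuousOn.strictMonoOn_of_injOn_Icc' zero_le_one hb.injOn
    with h | h
  · left
    refine ⟨le_antisymm ?_ (hb.mapsTo m0).1, le_antisymm (hb.mapsTo m1).2 ?_⟩
    · exact (h.monotoneOn m0 ha ha.1).trans ea.le
    · exact eb.ge.trans (h.monotoneOn hb' m1 hb'.2)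
  · right
    refine ⟨le_antisymm (hb.mapsTo m0).2 ?_, le_antisymm ?_ (hb.mapsTo m1).1⟩
    · exact eb.ge.trans (h.antitoneOn m0 hb' hb'.1)
    · exact (h.antitoneOn ha m1 ha.2).trans ea.le

theorem curve_ends (q : Fin M.nElem × Fin 3) :
    (M.curve (M.facet q) 0 = M.pos (M.vert q.1 (q.2 + 1)) ∧
      M.curve (M.facet q) 1 = M.pos (M.vert q.1 (q.2 + 2))) ∨
    (M.curve (M.facet q) 0 = M.pos (M.vert q.1 (q.2 + 2)) ∧
      M.curve (M.facet q) 1 = M.pos (M.vert q.1 (q.2 + 1))) := by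
  rw [M.curve_eq q (by simp), M.curve_eq q (by simp), ← M.chart_vert, ← M.chart_vert]
  rcases reparam_ends q.1 q.2 with ⟨h0, h1⟩ | ⟨h0, h1⟩ <;> simp [h0, h1, refEdge]

theorem mem_facetsAt {F : Fin M.nFacet} {E : Fin M.nVert} :
    F ∈ M.facetsAt E ↔ M.curve F 0 = M.pos E ∨ M.curve F 1 = M.pos E := by
  simp [facetsAt]

theorem facet_mem_facetsAt {q : Fin M.nElem × Fin 3} {E : Fin M.nVert} :
    M.facet q ∈ M.facetsAt E ↔ M.vert q.1 (q.2 + 1) = E ∨ M.vert q.1 (q.2 + 2) = E := by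
  rw [mem_facetsAt]
  rcases curve_ends q with ⟨h0, h1⟩ | ⟨h0, h1⟩ <;>
    simp only [h0, h1, M.pos_injective.eq_iff, or_comm]

theorem vert_injective (T : Fin M.nElem) : Function.Injective (M.vert T) := by
  intro i j h
  have hm : ∀ i, refVert i ∈ refTri := fun i => subset_convexHull ℝ _ (mem_range_self i)
  have h1 := M.chart_injOn T (hm i) (hm j) (by rw [M.chart_vert, M.chart_vert, h])
  have h2 := congrFun (congrArg (fun p : Pt => p.ofLp) h1)
  have h3 := h2 0
  have h4 := h2 1
  revert h3 h4
  fin_cases i <;> fin_cases j <;> simp [refVert]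

theorem endParam_mem (F : Fin M.nFacet) (E : Fin M.nVert) : M.endParam F E ∈ Icc (0 : ℝ) 1 := by
  unfold endParam
  split_ifs <;> simp

theorem curve_endParam {F : Fin M.nFacet} {E : Fin M.nVert} (h : F ∈ M.facetsAt E) :
    M.curve F (M.endParam F E) = M.pos E := by
  unfold endParam
  split_ifs with h0
  · exact h0
  · exact (mem_facetsAt.1 h).resolve_left h0

theorem endVelocity_eq (F : Fin M.nFacet) (E : Fin M.nVert) :
    ∃ c : ℝ, c ≠ 0 ∧ M.endVelocity F E = c • M.velocity F (M.endParam F E) := by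
  unfold endVelocity endParam
  split_ifs
  · exact ⟨1, one_ne_zero, (one_smul _ _).symm⟩
  · exact ⟨-1, by norm_num, by simp⟩

/-- At the vertex `(ν, n)` is orthonormal, so `orthonormal_tensor` returns `u` times `g(ν, ν) = 1`.
-/
theorem IsReggeMetric.Acnnc_toTensor (hg : M.IsReggeMetric g) (u : M.Scal) (E : Fin M.nVert) :
    M.Acnnc g (M.toTensor g u) E = M.vertVal u E := by
  have hE := M.vert_corner E
  rw [Acnnc, vertVal]
  generalize M.corner E = c at hE ⊢
  have hF : M.facet (c.1, c.2 + 1) ∈ M.facetsAt E := by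
    rw [facet_mem_facetsAt]
    right
    rw [← hE]
    congr 1
    simp [add_assoc]
  have hp := curve_endParam hF
  have hI := endParam_mem (M.facet (c.1, c.2 + 1)) E
  have hx : M.pos E ∈ M.body c.1 := by
    rw [← hp]
    exact M.curve_mem_body (c.1, c.2 + 1) hI
  have hm : M.metricAt g (c.1, c.2 + 1) (M.endParam (M.facet (c.1, c.2 + 1)) E)
      = g c.1 (M.pos E) := by rw [metricAt, hp]
  obtain ⟨a, ha, hv⟩ := endVelocity_eq (M.facet (c.1, c.2 + 1)) E
  have hv0 : M.endVelocity (M.facet (c.1, c.2 + 1)) E ≠ 0 := by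
    rw [hv]
    exact smul_ne_zero ha (M.velocity_ne_zero _ hI)
  have h1 := hg.normal_unit (c.1, c.2 + 1) hI
  have h2 := hg.tangent_ortho (c.1, c.2 + 1) hI
    (X := M.conormal g (c.1, c.2 + 1) E) (by
      rw [conormal, hv]
      exact Submodule.smul_mem _ _ (Submodule.smul_mem _ _ (M.velocity_mem_tangentLine _ _)))
  rw [hm] at h1 h2
  have h3 := orthonormal_tensor (hg.posDef _ _ hx) (hg.toTensor_eq u hx)
    (Y := M.conormal g (c.1, c.2 + 1) E) h1 h2
  rw [endNormal, h3, conormal, gunit_unit (hg.posDef _ _ hx) hv0, mul_one]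

theorem pos_mem_of_intVerts {E : Fin M.nVert} (hE : E ∈ M.intVerts) :
    M.pos E ∈ Ω := by
  have h1 : M.pos E ∉ frontier Ω := by simpa [intVerts] using hE
  have h2 : M.pos E ∈ closure Ω := by
    rw [← M.covers, ← M.vert_corner E, ← M.chart_vert]
    exact mem_iUnion.2 ⟨_, mem_image_of_mem _ (subset_convexHull ℝ _ (mem_range_self _))⟩
  by_contra h
  exact h1 ⟨h2, fun hi => h (interior_subset hi)⟩

theorem pos_mem_body (T : Fin M.nElem) (i : Fin 3) : M.pos (M.vert T i) ∈ M.body T := by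
  rw [← M.chart_vert]
  exact mem_image_of_mem _ (subset_convexHull ℝ _ (mem_range_self _))

theorem IsTestFun.vertVal_eq {u : M.Scal} (hu : M.IsTestFun u) {E : Fin M.nVert}
    (hE : E ∈ M.intVerts) {c : Fin M.nElem × Fin 3} (hc : M.vert c.1 c.2 = E) :
    u c.1 (M.pos E) = M.vertVal u E := by
  refine hu.continuous _ _ _ (pos_mem_of_intVerts hE) ?_ ?_
  · rw [← hc]; exact pos_mem_body _ _
  · have h := pos_mem_body (M := M) (M.corner E).1 (M.corner E).2
    rwa [M.vert_corner E] at h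

end CurvedMesh

namespace CurvedMesh

variable {Ω : Set Pt} {M : CurvedMesh Ω} {g : M.Fld2} {T : Fin M.nElem}

/-! ## Integrals and sums -/

theorem integralElem_congr {f h : Pt → ℝ} (e : ∀ x ∈ M.body T, f x = h x) :
    M.integralElem g T f = M.integralElem g T h :=
  setIntegral_congr_fun (M.measurableSet_body T) fun x hx => by simp only [e x hx]

theorem integralElem_const_mul (c : ℝ) (f : Pt → ℝ) :
    M.integralElem g T (fun x => c * f x) = c * M.integralElem g T f := by
  simp only [integralElem, mul_assoc]
  exact integral_const_mul _ _

theorem integralSide_congr {q : Fin M.nElem × Fin 3} {f h : ℝ → ℝ}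
    (e : ∀ s ∈ Icc (0 : ℝ) 1, f s = h s) : M.integralSide g q f = M.integralSide g q h := by
  refine intervalIntegral.integral_congr fun s hs => ?_
  rw [uIcc_of_le zero_le_one] at hs
  simp only [e s hs]

theorem frameInner_facetFrame (F : Fin M.nFacet) (s : ℝ) (B C : Pt → Pt → ℝ) :
    frameInner (M.facetFrame g F s) B C
      = B (M.unitTangent g (M.plus F) s) (M.unitTangent g (M.plus F) s)
        * C (M.unitTangent g (M.plus F) s) (M.unitTangent g (M.plus F) s) := by
  simp [frameInner, facetFrame]

/-- A facet integral of the form appearing in the functionals. -/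
theorem IsReggeMetric.integralFacet_eq (hg : M.IsReggeMetric g) (u : M.Scal) {F : Fin M.nFacet}
    (hF : F ∈ M.intFacets) {B : ℝ → Pt → Pt → Fin M.nElem × Fin 3 → ℝ}
    {b : ℝ → Fin M.nElem × Fin 3 → ℝ}
    (hB : ∀ s ∈ Icc (0 : ℝ) 1, ∀ q, B s (M.unitTangent g q s) (M.unitTangent g q s) q = b s q) :
    M.integralFacet g F (fun s =>
      frameInner (M.facetFrame g F s) (fun X Y => M.jump F fun q => B s X Y q)
        (M.Atnnt g (M.toTensor g u) (M.plus F) s))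
      = M.integralFacet g F (fun s => M.jump F (b s) * u (M.plus F).1 (M.curve F s)) := by
  refine integralSide_congr fun s hs => ?_
  have hp := M.facet_plus F
  rw [frameInner_facetFrame, hg.Atnnt_toTensor u (M.plus F) hs _
    (unitTangent_mem_tangentLine rfl s), hg.unitTangent_unit (M.plus F) hs, mul_one, hp]
  congr 1
  refine Finset.sum_congr rfl fun q hq => ?_
  -- Each summand of the jump is moved to the unit tangent of its own side; these agree because the
  -- tangential metric is single-valued.
  rw [hg.unitTangent_side hF hp (M.mem_sides.1 hq) hs]
  exact hB s hs q

/-- Double counting of the pairs (element, facet of it ending at `E`): the facets of a triangle at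
its vertex `i` are those opposite to `i + 1` and `i + 2`. -/
theorem sum_facetsAt (E : Fin M.nVert) (f : Fin M.nElem × Fin 3 → ℝ) :
    ∑ F ∈ M.facetsAt E, M.jump F f
      = ∑ c ∈ M.cornersAt E, (f (c.1, c.2 + 1) + f (c.1, c.2 + 2)) := by
  classical
  simp only [jump, sides, cornersAt, Finset.sum_filter]
  rw [Finset.sum_comm]
  simp only [Finset.sum_ite_eq]
  rw [Fintype.sum_prod_type, Fintype.sum_prod_type]
  refine Finset.sum_congr rfl fun T _ => ?_
  -- The two ends of a facet are distinct vertices of `T`, so the indicator of the disjunction is a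
  -- sum of indicators.
  have h : ∀ k, (if M.edge T k ∈ M.facetsAt E then f (T, k) else 0)
      = (if M.vert T (k + 1) = E then f (T, k) else 0)
        + if M.vert T (k + 2) = E then f (T, k) else 0 := by
    intro k
    have h1 : M.edge T k ∈ M.facetsAt E ↔ M.vert T (k + 1) = E ∨ M.vert T (k + 2) = E :=
      facet_mem_facetsAt (q := (T, k))
    by_cases ha : M.vert T (k + 1) = E
    · have hb : M.vert T (k + 2) ≠ E := by
        intro hb
        have := vert_injective T (ha.trans hb.symm)
        revert this
        fin_cases k <;> decide
      simp [h1, ha, hb]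
    · simp [h1, ha]
  simp only [h, Fin.sum_univ_three]
  have e1 : (1 + 1 : Fin 3) = 2 := rfl
  have e2 : (2 + 1 : Fin 3) = 0 := rfl
  have e3 : (1 + 2 : Fin 3) = 0 := rfl
  have e4 : (2 + 2 : Fin 3) = 1 := rfl
  simp only [zero_add, e1, e2, e3, e4]
  split_ifs <;> ring

theorem sum_sides (f : Fin M.nElem × Fin 3 → ℝ) :
    ∑ T, ∑ k, f (T, k) = ∑ F, ∑ q ∈ M.sides F, f q := by
  rw [← Fintype.sum_prod_type]
  exact (Finset.sum_fiberwise Finset.univ (fun q : Fin M.nElem × Fin 3 => M.edge q.1 q.2) f).symm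

/-- The sum of the integrals over the element boundaries, arranged by facets. -/
theorem IsReggeMetric.sum_integralSide (hg : M.IsReggeMetric g)
    {u : M.Scal} (hu : M.IsTestFun₀ u) {b : Fin M.nElem × Fin 3 → ℝ → ℝ}
    (hb : ∀ q, ContDiffOn ℝ ∞ (b q) (Icc 0 1)) :
    ∑ T, ∑ k, M.integralSide g (T, k) (fun s =>
        b (T, k) s * u T (M.curve (M.facet (T, k)) s))
      = ∑ F ∈ M.intFacets, M.integralFacet g F (fun s =>
        (M.jump F fun q => b q s) * u (M.plus F).1 (M.curve F s)) := by
  rw [sum_sides fun q => M.integralSide g q fun s => b q s * u q.1 (M.curve (M.facet q) s)]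
  symm
  -- Boundary facets contribute nothing because `u` vanishes there; on interior ones both sides
  -- share the arc length and the values of `u`.
  refine Finset.sum_subset_zero_on_sdiff (Finset.subset_univ _) (fun F hF => ?_) fun F hF => ?_
  · refine Finset.sum_eq_zero fun q hq => ?_
    have hq' := M.mem_sides.1 hq
    rw [integralSide_congr (h := fun _ => 0)]
    · simp [integralSide]
    · intro s hs
      rw [hq', hu.vanishes F (Finset.mem_sdiff.1 hF).2 q hq s hs, mul_zero]
  · have hp := M.facet_plus F
    have h : ∀ q ∈ M.sides F,
        (M.integralSide g q fun s => b q s * u q.1 (M.curve (M.facet q) s))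
        = ∫ s in (0 : ℝ)..1, b q s * u (M.plus F).1 (M.curve F s) *
          Real.sqrt (ev2 (M.metricAt g (M.plus F) s) (M.velocity F s) (M.velocity F s)) := by
      intro q hq
      have hq' := M.mem_sides.1 hq
      refine intervalIntegral.integral_congr fun s hs => ?_
      rw [uIcc_of_le zero_le_one] at hs
      simp only [hq']
      rw [hg.metricAt_velocity hF hq' hp hs, hu.toIsTestFun.eq_on_facet hF hq' hp hs]
    rw [Finset.sum_congr rfl h, ← intervalIntegral.integral_finsetSum]
    · simp only [integralFacet, integralSide, jump, Finset.sum_mul, hp]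
    · intro q hq
      refine ContinuousOn.intervalIntegrable ?_
      rw [uIcc_of_le zero_le_one]
      have h1 : ContinuousOn (fun s => u (M.plus F).1 (M.curve F s)) (Icc 0 1) := by
        have h2 := (hu.smooth (M.plus F).1).continuousOn.comp
          (M.contDiffOn_curve (M.plus F)).continuousOn (M.mapsTo_curve (M.plus F))
        rwa [hp] at h2
      have h3 : ContinuousOn (fun s =>
          ev2 (M.metricAt g (M.plus F) s) (M.velocity F s) (M.velocity F s)) (Icc 0 1) := by
        have h4 := M.contDiffOn_velocity (M.plus F)
        rw [hp] at h4
        exact (contDiffOn_ev2 (hg.contDiffOn_metricAt (M.plus F)) h4 h4).continuousOn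
      exact ((hb q).continuousOn.mul h1).mul h3.sqrt

/-! ## The test spaces -/

theorem IsReggeMetric.isTestTensor_toTensor (hg : M.IsReggeMetric g) {u : M.Scal}
    (hu : M.IsTestFun u) : M.IsTestTensor g (M.toTensor g u) where
  smooth T i j k l := (((hu.smooth T).mul (contDiffOn_det (hg.smooth T))).mul
    (contDiffOn_const (c := permSym i j)) |>.mul (contDiffOn_const (c := permSym l k))).congr
      fun x hx => hg.toTensor_eq u hx i j k l
  skew_left T x hx i j k l := by
    rw [hg.toTensor_eq u hx, hg.toTensor_eq u hx, permSym_swap i j]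
    ring
  skew_right T x hx i j k l := by
    rw [hg.toTensor_eq u hx, hg.toTensor_eq u hx, permSym_swap l k]
    ring
  pair_symm T x hx i j k l := by
    rw [hg.toTensor_eq u hx, hg.toTensor_eq u hx, permSym_swap i j, permSym_swap l k]
    ring
  single_valued F hF q hq q' hq' s hs X hX Y hY := by
    have hf := M.mem_sides.1 hq
    have hf' := M.mem_sides.1 hq'
    rw [hg.Atnnt_toTensor u q hs Y (hf ▸ hX), hg.Atnnt_toTensor u q' hs Y (hf' ▸ hX),
      metricAt, metricAt, hf, hf', hu.eq_on_facet hF hf hf' hs,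
      hg.tt_continuous F hF q hq q' hq' s hs X hX Y hY]

theorem IsReggeMetric.isTestTensor₀_toTensor (hg : M.IsReggeMetric g) {u : M.Scal}
    (hu : M.IsTestFun₀ u) : M.IsTestTensor₀ g (M.toTensor g u) where
  toIsTestTensor := hg.isTestTensor_toTensor hu.toIsTestFun
  vanishes F hF q hq s hs X hX Y _ := by
    have hf := M.mem_sides.1 hq
    rw [hg.Atnnt_toTensor u q hs Y (hf ▸ hX), hf, hu.vanishes F hF q hq s hs, zero_mul]

/-- The function `u` for which a tensor with the symmetries of the curvature tensor
is `-u ω ⊗ ω`. -/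
def ofTensor (g : M.Fld2) (A : M.Fld4) : M.Scal := fun T x => A T x 0 1 1 0 / (g T x).det

theorem IsReggeMetric.eq_ofTensor (hg : M.IsReggeMetric g) {A : M.Fld4} (hA : M.IsTestTensor g A)
    (T : Fin M.nElem) (x : Pt) (hx : x ∈ M.body T) (i j k l : Fin 2) :
    A T x i j k l = ofTensor g A T x * (g T x).det * permSym i j * permSym l k := by
  have hL : ∀ i j k l, A T x i j k l = permSym i j * A T x 0 1 k l := by
    intro i j k l
    have h := hA.skew_left T x hx i j k l
    fin_cases i <;> fin_cases j <;> simp [permSym] at h ⊢ <;> linarith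
  have hR : ∀ k l, A T x 0 1 k l = permSym l k * A T x 0 1 1 0 := by
    intro k l
    have h := hA.skew_right T x hx 0 1 k l
    fin_cases k <;> fin_cases l <;> simp [permSym] at h ⊢ <;> linarith
  rw [hL, hR, ofTensor, div_mul_cancel₀ _ (hg.posDef T x hx).det_pos.ne']
  ring

theorem IsReggeMetric.Atnnt_velocity (hg : M.IsReggeMetric g) {A : M.Fld4}
    (hA : M.IsTestTensor g A) {F : Fin M.nFacet} {q : Fin M.nElem × Fin 3} (hq : M.facet q = F)
    {s : ℝ} (hs : s ∈ Icc (0 : ℝ) 1) :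
    M.Atnnt g A q s (M.velocity F s) (M.velocity F s)
      = ofTensor g A q.1 (M.curve F s) *
        ev2 (M.metricAt g q s) (M.velocity F s) (M.velocity F s) := by
  subst hq
  exact hg.Atnnt_of_eq (hg.eq_ofTensor hA) q hs _ (M.velocity_mem_tangentLine _ _)

/-- Evaluated on the velocity, the facet condition reads `u |γ'|²` from both sides. The squared
length is common and positive, so it cancels, and `eq_of_facets` extends the equality to `Ω`. -/
theorem IsReggeMetric.isTestFun_ofTensor (hΩ : IsOpen Ω) (hg : M.IsReggeMetric g) {A : M.Fld4}
    (hA : M.IsTestTensor g A) : M.IsTestFun (ofTensor g A) where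
  smooth T := (hA.smooth T 0 1 1 0).div (contDiffOn_det (hg.smooth T))
    fun x hx => (hg.posDef T x hx).det_pos.ne'
  continuous := by
    refine eq_of_facets hΩ fun F hF q hq q' hq' s hs => ?_
    have hf := M.mem_sides.1 hq
    have hf' := M.mem_sides.1 hq'
    have h := hA.single_valued F hF q hq q' hq' s hs _ (M.velocity_mem_tangentLine F s) _
      (M.velocity_mem_tangentLine F s)
    rw [hg.Atnnt_velocity hA hf hs, hg.Atnnt_velocity hA hf' hs,
      hg.metricAt_velocity hF hf hf' hs] at h
    refine mul_right_cancel₀ ?_ h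
    subst hf'
    exact (posDef_ev2_pos (hg.posDef_metricAt q' hs) (M.velocity_ne_zero q' hs)).ne'

theorem IsReggeMetric.isTestFun₀_ofTensor (hΩ : IsOpen Ω) (hg : M.IsReggeMetric g) {A : M.Fld4}
    (hA : M.IsTestTensor₀ g A) : M.IsTestFun₀ (ofTensor g A) where
  toIsTestFun := hg.isTestFun_ofTensor hΩ hA.toIsTestTensor
  vanishes F hF q hq s hs := by
    have hf := M.mem_sides.1 hq
    have h := hA.vanishes F hF q hq s hs _ (M.velocity_mem_tangentLine F s) _
      (M.velocity_mem_tangentLine F s)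
    rw [hg.Atnnt_velocity hA.toIsTestTensor hf hs] at h
    refine (mul_eq_zero.1 h).resolve_right ?_
    subst hf
    exact (posDef_ev2_pos (hg.posDef_metricAt q hs) (M.velocity_ne_zero q hs)).ne'

theorem IsReggeMetric.toTensor_ofTensor (hg : M.IsReggeMetric g) {A : M.Fld4}
    (hA : M.IsTestTensor g A) (T : Fin M.nElem) (x : Pt) (hx : x ∈ M.body T) :
    A T x = M.toTensor g (ofTensor g A) T x := by
  funext i j k l
  rw [hg.eq_ofTensor hA T x hx, hg.toTensor_eq _ hx]

/-! ## The functionals -/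

theorem IsReggeMetric.riemannFunctional_toTensor (hg : M.IsReggeMetric g) (u : M.Scal) :
    1 / 4 * M.riemannFunctional g (M.toTensor g u) = M.gaussFunctional g u := by
  have h1 : ∀ T, M.integralElem g T (fun x =>
      inner4 (g T x) (M.riemann g T x) (M.toTensor g u T x))
      = 4 * M.integralElem g T (fun x => M.gauss g T x * u T x) := fun T => by
    rw [← integralElem_const_mul]
    exact integralElem_congr fun x hx => hg.inner4_riemann u hx
  have h2 := Finset.sum_congr rfl fun F (hF : F ∈ M.intFacets) =>
    hg.integralFacet_eq u hF (B := fun s X Y q => M.sff g q s X Y)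
      (b := fun s q => M.geodCurv g q s) fun s hs q => hg.sff_unitTangent q hs
  rw [riemannFunctional, h2]
  simp only [h1, hg.Acnnc_toTensor, gaussFunctional, ← Finset.mul_sum]
  ring

theorem IsReggeMetric.aForm_eq_zero (hg : M.IsReggeMetric g) (σ : M.Fld2) (u : M.Scal) :
    M.aForm g σ u = 0 := by
  have h1 : ∀ T, M.integralElem g T (fun x =>
      inner4 (g T x) (Lfirst (g T x) (σ T x) (M.riemann g T x)) (M.toTensor g u T x)
      - gtrace (g T x) (σ T x) / 2 * inner4 (g T x) (M.riemann g T x) (M.toTensor g u T x))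
      = 0 := fun T => by
    rw [integralElem_congr (h := fun _ => 0) fun x hx => hg.inner4_Lfirst _ u hx]
    simp [integralElem]
  have h2 : ∀ F, M.integralFacet g F (fun s =>
      frameTriple (M.facetFrame g F s) (fun X Y => M.jump F fun q => M.sff g q s X Y)
        (traceReversed (M.metricAt g (M.plus F) s) (σ (M.plus F).1 (M.curve F s))
          (M.facetFrame g F s))
        (M.Atnnt g (M.toTensor g u) (M.plus F) s)) = 0 := fun F => by
    rw [integralFacet, integralSide_congr (h := fun _ => 0)]
    · simp [integralSide]
    · intro s hs
      -- On the single frame vector `t` the trace-reversed part is `σ(t, t) - σ(t, t) g(t, t) = 0`.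
      simp [frameTriple, traceReversed, frameTrace, facetFrame, hg.unitTangent_unit _ hs]
  simp [aForm, h1, h2, frameTrace]

theorem IsReggeMetric.bForm_eq (hg : M.IsReggeMetric g) {σ : M.Fld2} (hσ : M.IsRegge σ)
    (u : M.Scal) (ε : ℝ) :
    M.bForm ε g σ u =
      -2 * ∑ T, M.integralElem g T (fun x => M.inc g σ T x * u T x)
      + 2 * ∑ F ∈ M.intFacets, M.integralFacet g F (fun s =>
          (M.jump F fun q => M.curlTerm g σ q s) * u (M.plus F).1 (M.curve F s))
      + ε * (2 * ∑ E ∈ M.intVerts, ∑ F ∈ M.facetsAt E,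
          (M.jump F fun q => M.sigmaNC g σ q E) * M.vertVal u E) := by
  have h1 : ∀ T, M.integralElem g T (fun x =>
      inner4 (g T x) (M.cov2 g σ T x) (swap23 (M.toTensor g u T x)))
      = -1 * M.integralElem g T (fun x => M.inc g σ T x * u T x) := fun T => by
    rw [← integralElem_const_mul]
    exact integralElem_congr fun x hx => by rw [hg.inner4_cov2 hσ u hx, neg_one_mul]
  have h2 := Finset.sum_congr rfl fun F (hF : F ∈ M.intFacets) =>
    hg.integralFacet_eq u hF (B := fun s X Y q => M.bFacetTensor g σ q s X Y)
      (b := fun s q => M.curlTerm g σ q s) fun s hs q => hg.bFacetTensor_unitTangent hσ q hs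
  rw [bForm, h2]
  simp only [h1, hg.Acnnc_toTensor, ← Finset.mul_sum]
  ring

/-- The factor `ε = 1` is what matches the vertex terms: regrouped by corners, the jumps of `σ(n,
ν)` are exactly those of the distributional operator. -/
theorem IsReggeMetric.bForm_one (hg : M.IsReggeMetric g) {σ : M.Fld2}
    (hσ : M.IsRegge σ) {u : M.Scal} (hu : M.IsTestFun₀ u) :
    M.bForm 1 g σ u = -2 * M.incFunctional g σ u := by
  have h1 : ∑ E ∈ M.intVerts, ∑ c ∈ M.cornersAt E,
      (M.sigmaNC g σ (c.1, c.2 + 1) E + M.sigmaNC g σ (c.1, c.2 + 2) E) * u c.1 (M.pos E)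
      = ∑ E ∈ M.intVerts, ∑ F ∈ M.facetsAt E,
          (M.jump F fun q => M.sigmaNC g σ q E) * M.vertVal u E := by
    refine Finset.sum_congr rfl fun E hE => ?_
    rw [← Finset.sum_mul, sum_facetsAt, Finset.sum_mul]
    refine Finset.sum_congr rfl fun c hc => ?_
    rw [hu.toIsTestFun.vertVal_eq hE (by simpa [cornersAt] using hc)]
  rw [hg.bForm_eq hσ, incFunctional, Finset.sum_sub_distrib,
    hg.sum_integralSide hu fun q => hg.contDiffOn_curlTerm hσ q, h1]
  ring

end CurvedMesh

end

end ReggeCurvature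

theorem mainTheorem8 (Ω : Set Pt) (hΩ : IsOpen Ω) (M : CurvedMesh Ω)
    (g : M.Fld2) (hg : M.IsReggeMetric g) :
    -- the test tensors are exactly the tensors `-u ω ⊗ ω`
    ((∀ u : M.Scal, M.IsTestFun u → M.IsTestTensor g (M.toTensor g u)) ∧
      (∀ A : M.Fld4, M.IsTestTensor g A → ∃ u : M.Scal, M.IsTestFun u ∧
        ∀ T, ∀ x ∈ M.body T, A T x = M.toTensor g u T x) ∧
      (∀ u : M.Scal, M.IsTestFun₀ u → M.IsTestTensor₀ g (M.toTensor g u)) ∧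
      (∀ A : M.Fld4, M.IsTestTensor₀ g A → ∃ u : M.Scal, M.IsTestFun₀ u ∧
        ∀ T, ∀ x ∈ M.body T, A T x = M.toTensor g u T x)) ∧
    -- reduction to the Gauss curvature
    (∀ u : M.Scal, M.IsTestFun₀ u →
      1 / 4 * M.riemannFunctional g (M.toTensor g u) = M.gaussFunctional g u) ∧
    -- the bilinear forms
    (∀ σ : M.Fld2, M.IsRegge σ → ∀ u : M.Scal, M.IsTestFun u →
      M.aForm g σ u = 0 ∧
      ∀ ε : ℝ, M.bForm ε g σ u =
        -2 * ∑ T, M.integralElem g T (fun x => M.inc g σ T x * u T x)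
        + 2 * ∑ F ∈ M.intFacets, M.integralFacet g F (fun s =>
            (M.jump F fun q => M.curlTerm g σ q s) * u (M.plus F).1 (M.curve F s))
        + ε * (2 * ∑ E ∈ M.intVerts, ∑ F ∈ M.facetsAt E,
            (M.jump F fun q => M.sigmaNC g σ q E) * M.vertVal u E)) ∧
    -- the incompatibility operator
    (∀ σ : M.Fld2, M.IsRegge σ → ∀ u : M.Scal, M.IsTestFun₀ u →
      M.bForm 1 g σ u = -2 * M.incFunctional g σ u) := by
  refine ⟨⟨fun u hu => hg.isTestTensor_toTensor hu, fun A hA => ⟨_, hg.isTestFun_ofTensor hΩ hA,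
    hg.toTensor_ofTensor hA⟩, fun u hu => hg.isTestTensor₀_toTensor hu, fun A hA =>
    ⟨_, hg.isTestFun₀_ofTensor hΩ hA, hg.toTensor_ofTensor hA.toIsTestTensor⟩⟩,
    fun u _ => hg.riemannFunctional_toTensor u,
    fun σ hσ u _ => ⟨hg.aForm_eq_zero σ u, hg.bForm_eq hσ u⟩,
    fun σ hσ u hu => hg.bForm_one hσ hu⟩
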